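/- Let $\mathcal{M}=(S,s_0,\mathcal{A},\mathcal{P},\mathcal{AP},\mathcal{L},\mathcal{R})$ be a finite Markov decision process: finite sets $S$, $\mathcal{A}$ of states and actions, an initial state $s_0\in S$, nonempty sets $\mathcal{A}(s)\subseteq\mathcal{A}$ of available actions, transition probabilities $\mathcal{P}_{s,a,s'}$, a labelling $\mathcal{L}:S\to 2^{\mathcal{AP}}$ and a reward function $\mathcal{R}:S\times\mathcal{A}\to\mathbb{R}$. Let $\varphi$ be a syntactically co-safe LTL formula over $\mathcal{AP}$. A path $s_0s_1s_2\ldots$ satisfies $\varphi$ if the word $\mathcal{L}(s_0)\mathcal{L}(s_1)\ldots$ does. A decision rule $d$ assigns to each state $s$ a probability distribution $d(s,\cdot)$ on $\mathcal{A}(s)$, and a policy prescribes for every finite path fragment $s_0\ldots s_t$ a decision rule, which is used at stage $t+1$. An agent with decision horizon $N$ plans anew every $N$ stages, and the principal observes the path. At the beginning of the $k$-th block of $N$ stages ($k=0,1,\ldots$), when the path fragment $h=s_0\ldots s_{kN}$ has been observed, the principal offers incentive functions $\gamma^h_1,\ldots,\gamma^h_N:S\times\mathcal{A}\to[0,\infty)$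 for the next $N$ stages. The family $\Gamma=(\gamma^h)_h$ is an incentive design. The agent then computes and implements an $N$-stage policy $\pi_h=(d_1,\ldots,d_N)$ which, simultaneously for all starting states $s\in S$, maximizes \[ \mathbb{E}^{\pi_h}_s\Big[\sum_{n=1}^{N}\big(\mathcal{R}(S_n,A_n)+\gamma^h_n(S_n,A_n)\big)\Big] \] over all $N$-stage policies. An infinite-stage policy $\pi^\star$ obtained by concatenating such maximizers is called an optimal agent policy under $\Gamma$. The pair $(\Gamma,\pi^\star)$ is feasible if moreover $\pi^\star$ maximizes the probability, starting from $s_0$, of satisfying $\varphi$ over all policies. The cost of $(\Gamma,\pi^\star)$ is the expected total amount $\mathbb{E}^{\pi^\star}_{s_0}\big[\sum_{t=1}^{\infty}\gamma_t(S_t,A_t)\big]\in[0,\infty]$ of incentives paid, where $\gamma_t$ is the incentive function that $\Gamma$ offers for stage $t$ along the observed path. For $\bar\epsilon>0$, the design $\Gamma$ is $\bar\epsilon$-optimal if there is an optimal agent policy under $\Gamma$ and, for every optimal agent policy $\pi^\star$ under $\Gamma$, the pair $(\Gamma,\pi^\star)$ is feasible, has finite cost, and its cost is at most $\bar\epsilon$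 larger than the cost of any feasible pair $(\Gamma',\pi')$. \textbf{Claim.} If the agent's decision horizon is $N=1$, then for every $\bar\epsilon>0$ there exists an $\bar\epsilon$-optimal incentive design on $\mathcal{M}$ for $\varphi$. -/

import Mathlib

open MeasureTheory ProbabilityTheory
open scoped NNReal ENNReal

/-! ### Syntactically co-safe linear temporal logic -/

/-- Syntactically co-safe LTL formulae over a set `AP` of atomic propositions: negation is applied
to atomic propositions only, and the temporal operators are next, until and eventually. -/
inductive ScLTL (AP : Type*) where
  | tt : ScLTL AP
  | atom : AP → ScLTL AP
  | natom : AP → ScLTL AP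
  | conj : ScLTL AP → ScLTL AP → ScLTL AP
  | disj : ScLTL AP → ScLTL AP → ScLTL AP
  | next : ScLTL AP → ScLTL AP
  | untl : ScLTL AP → ScLTL AP → ScLTL AP
  | ev : ScLTL AP → ScLTL AP

/-- `φ.Sat w k`: the suffix `w_k w_{k+1} …` of the infinite word `w` satisfies `φ`. -/
def ScLTL.Sat {AP : Type*} : ScLTL AP → (ℕ → Set AP) → ℕ → Prop
  | .tt, _, _ => True
  | .atom p, w, k => p ∈ w k
  | .natom p, w, k => p ∉ w k
  | .conj φ ψ, w, k => φ.Sat w k ∧ ψ.Sat w k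
  | .disj φ ψ, w, k => φ.Sat w k ∨ ψ.Sat w k
  | .next φ, w, k => φ.Sat w (k + 1)
  | .untl φ ψ, w, k => ∃ j, k ≤ j ∧ ψ.Sat w j ∧ ∀ i, k ≤ i → i < j → φ.Sat w i
  | .ev φ, w, k => ∃ j, k ≤ j ∧ φ.Sat w j

/-- The word `w` satisfies `φ`. -/
def ScLTL.Models {AP : Type*} (w : ℕ → Set AP) (φ : ScLTL AP) : Prop := φ.Sat w 0

/-! ### Markov decision processes -/

/-- A finite Markov decision process (finiteness of the state and action types is supplied by the
`Fintype` instances). `avail s` is the set of actions available in `s`; the values of `P s a` for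
an action `a` that is not available in `s` play no role. -/
structure FinMDP (S A AP : Type*) [Fintype S] where
  init : S
  avail : S → Finset A
  avail_nonempty : ∀ s, (avail s).Nonempty
  P : S → A → S → ℝ
  P_nonneg : ∀ s, ∀ a ∈ avail s, ∀ s', 0 ≤ P s a s'
  P_sum : ∀ s, ∀ a ∈ avail s, ∑ s', P s a s' = 1
  label : S → Set AP
  reward : S → A → ℝ

namespace FinMDP

variable {S A AP : Type*} [Fintype S] [Fintype A]

/-- A (randomized) decision rule. -/
structure DecisionRule (M : FinMDP S A AP) where
  prob : S → A → ℝ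
  nonneg : ∀ s a, 0 ≤ prob s a
  eq_zero : ∀ s, ∀ a ∉ M.avail s, prob s a = 0
  sum_eq_one : ∀ s, ∑ a ∈ M.avail s, prob s a = 1

/-- The distribution of the action chosen by the decision rule `d` in the state `s`. -/
noncomputable def DecisionRule.toPMF {M : FinMDP S A AP} (d : M.DecisionRule) (s : S) : PMF A :=
  PMF.ofFintype (fun a => ENNReal.ofReal (d.prob s a)) (by
    rw [← ENNReal.ofReal_sum_of_nonneg (fun a _ => d.nonneg s a),
      ← Finset.sum_subset (Finset.subset_univ (M.avail s)) (fun a _ ha => d.eq_zero s a ha),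
      d.sum_eq_one s, ENNReal.ofReal_one])

open Classical in
/-- The distribution of the successor state of `s` under the action `a`; an action that is not
available (which is never taken) is given an irrelevant default. -/
noncomputable def stepPMF (M : FinMDP S A AP) (s : S) (a : A) : PMF S :=
  if h : a ∈ M.avail s then
    PMF.ofFintype (fun s' => ENNReal.ofReal (M.P s a s')) (by
      rw [← ENNReal.ofReal_sum_of_nonneg (fun s' _ => M.P_nonneg s a h s'),
        M.P_sum s a h, ENNReal.ofReal_one])
  else PMF.pure s

/-- An infinite-stage policy `(d_1, d_2, …)`: the decision rule used at a stage may depend on the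
path fragment `s_0 s_1 … s_t` (a nonempty list of states, the last one being the current state)
that has been observed up to that stage. -/
def Policy (M : FinMDP S A AP) := List S → M.DecisionRule

/-- The sequence of states in a sequence `(s_0,a_0), …, (s_n,a_n)`. -/
def statesOf {n : ℕ} (x : Finset.Iic n → S × A) : List S :=
  List.ofFn fun i : Fin (n + 1) => (x ⟨i, Finset.mem_Iic.2 (Nat.lt_succ_iff.1 i.isLt)⟩).1

/-- The path fragment `s_0 s_1 … s_t` of `ω = (s_0,a_0), (s_1,a_1), …`. -/
def pathTo (ω : ℕ → S × A) (t : ℕ) : List S :=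
  List.ofFn fun i : Fin (t + 1) => (ω i).1

section Measure

variable [MeasurableSpace S] [DiscreteMeasurableSpace S]
  [MeasurableSpace A] [DiscreteMeasurableSpace A]

/-- The law of the next state-action pair, given `(s_0,a_0), …, (s_n,a_n)`: the state `s'` is drawn
from the transition function, then the action from the rule the policy prescribes for
`s_0 … s_n s'`. -/
noncomputable def stepKernel (M : FinMDP S A AP) (π : M.Policy) (n : ℕ) :
    Kernel (Finset.Iic n → S × A) (S × A) :=
  Kernel.ofFunOfCountable fun x =>
    ((M.stepPMF (x ⟨n, Finset.mem_Iic.2 le_rfl⟩).1 (x ⟨n, Finset.mem_Iic.2 le_rfl⟩).2).bind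
      fun s' => ((π (statesOf x ++ [s'])).toPMF s').map fun a' => (s', a')).toMeasure

instance (M : FinMDP S A AP) (π : M.Policy) (n : ℕ) : IsMarkovKernel (M.stepKernel π n) :=
  ⟨fun _ => by
    unfold stepKernel Kernel.ofFunOfCountable
    exact PMF.toMeasure.isProbabilityMeasure _⟩

/-- The probability measure that the policy `π` induces on the infinite sequences
`(s_0,a_0), (s_1,a_1), …` of state-action pairs starting in the initial state. -/
noncomputable def pathMeasure (M : FinMDP S A AP) (π : M.Policy) : Measure (ℕ → S × A) :=
  Kernel.trajMeasure (X := fun _ => S × A)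
    (((π [M.init]).toPMF M.init).map fun a => (M.init, a)).toMeasure (M.stepKernel π)

/-- The probability that the path generated under `π` satisfies `φ`. -/
noncomputable def probSat (M : FinMDP S A AP) (π : M.Policy) (φ : ScLTL AP) : ℝ≥0∞ :=
  M.pathMeasure π {ω | ScLTL.Models (fun t => M.label (ω t).1) φ}

end Measure

/-! ### The agent -/

open Classical in
/-- `M.occ d s t s' a`: the joint probability of being in `s'` and taking the action `a` at stage
`t + 1`, when the process starts in `s` and the decision rules `d 0, d 1, …` are used. -/
noncomputable def occ (M : FinMDP S A AP) (d : ℕ → M.DecisionRule) (s : S) : ℕ → S → A → ℝ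
  | 0 => fun s' a => if s' = s then (d 0).prob s' a else 0
  | t + 1 => fun s' a' =>
      (∑ r, ∑ a ∈ M.avail r, M.P r a s' * M.occ d s t r a) * (d (t + 1)).prob s' a'

/-- The expected total reward plus incentive over `N` stages, of the `N`-stage policy `d` started in
`s`, when the incentives `γ 0, …, γ (N - 1)` are offered for these stages. -/
noncomputable def J (M : FinMDP S A AP) {N : ℕ} [NeZero N] (d : Fin N → M.DecisionRule)
    (γ : Fin N → S → A → ℝ≥0) (s : S) : ℝ :=
  ∑ n : Fin N, ∑ s', ∑ a ∈ M.avail s',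
    M.occ (fun t => d (Fin.ofNat N t)) s n s' a * (M.reward s' a + γ n s' a)

/-- An incentive design against an agent with decision horizon `N`. Stages are grouped in blocks of
length `N`. At the beginning of the `k`-th block the principal has observed the path fragment
`h = s_0 … s_{kN}` and offers the incentive functions `Γ h 0, …, Γ h (N - 1)` for the stages
`kN + 1, …, kN + N`. -/
def IncentiveDesign (_M : FinMDP S A AP) (N : ℕ) := List S → Fin N → S → A → ℝ≥0

/-- The agent's planning: at the beginning of the `k`-th block, after the path fragment
`h = s_0 … s_{kN}`, the `N`-stage policy `σ h` is computed. -/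
def Plan (M : FinMDP S A AP) (N : ℕ) := List S → Fin N → M.DecisionRule

/-- `σ` is optimal for the agent under `Γ`: every `N`-stage policy it computes maximizes the
agent's objective for the incentives on offer, from every state. -/
def IsOptimalPlan (M : FinMDP S A AP) {N : ℕ} [NeZero N] (Γ : M.IncentiveDesign N)
    (σ : M.Plan N) : Prop :=
  ∀ (h : List S) (d : Fin N → M.DecisionRule) (s : S), M.J d (Γ h) s ≤ M.J (σ h) (Γ h) s

/-- The path fragment `s_0 … s_{kN}` known at the beginning of the block that contains the stage
with history `h = s_0 … s_t` (so `k = t / N`). -/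
def blockStart (N : ℕ) (h : List S) : List S := h.take ((h.length - 1) / N * N + 1)

/-- The infinite-stage policy resulting from the concatenation of the computed `N`-stage
policies. -/
def Plan.toPolicy {M : FinMDP S A AP} {N : ℕ} [NeZero N] (σ : M.Plan N) : M.Policy :=
  fun h => σ (blockStart N h) (Fin.ofNat N (h.length - 1))

/-! ### Optimal incentive designs -/

section Design

variable [MeasurableSpace S] [DiscreteMeasurableSpace S]
  [MeasurableSpace A] [DiscreteMeasurableSpace A]

/-- The policy `π` satisfies `φ` with maximum probability. -/
def IsMaxProb (M : FinMDP S A AP) (φ : ScLTL AP) (π : M.Policy) : Prop :=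
  ∀ π' : M.Policy, M.probSat π' φ ≤ M.probSat π φ

/-- The expected total amount of incentives paid under the design `Γ` when the agent uses `σ`. -/
noncomputable def cost (M : FinMDP S A AP) {N : ℕ} [NeZero N] (Γ : M.IncentiveDesign N)
    (σ : M.Plan N) : ℝ≥0∞ :=
  ∫⁻ ω, ∑' t : ℕ,
    (Γ (blockStart N (pathTo ω t)) (Fin.ofNat N t) (ω t).1 (ω t).2 : ℝ≥0∞)
      ∂(M.pathMeasure σ.toPolicy)

/-- `Γ` is an `ε`-optimal incentive design for the objective `φ`: the agent has an optimal plan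
under `Γ`, and whichever optimal plan it uses, `φ` is satisfied with maximum probability and the
cost is finite and exceeds by at most `ε` the cost of any feasible solution `(Γ', σ')` of the
principal's problem. -/
def IsEpsOptimalDesign (M : FinMDP S A AP) {N : ℕ} [NeZero N] (φ : ScLTL AP) (ε : ℝ≥0)
    (Γ : M.IncentiveDesign N) : Prop :=
  (∃ σ : M.Plan N, M.IsOptimalPlan Γ σ) ∧
  ∀ σ : M.Plan N, M.IsOptimalPlan Γ σ →
    M.IsMaxProb φ σ.toPolicy ∧ M.cost Γ σ ≠ ∞ ∧
    ∀ (Γ' : M.IncentiveDesign N) (σ' : M.Plan N),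
      M.IsOptimalPlan Γ' σ' → M.IsMaxProb φ σ'.toPolicy → M.cost Γ σ ≤ M.cost Γ' σ' + ε

end Design

end FinMDP

/-! An agent with horizon one takes an action only if the incentive covers its `gap`, the reward
lost against the best available action. Conversely, paying the gap plus any δ > 0 for one action
makes it the strict optimum. The principal thus faces a stochastic shortest path problem with step
cost `gap`, on the product of the process with the automaton of residual languages of φ. This
product is finite (`finite_range_residual`), and satisfying φ means reaching its good states
(`models_iff_exists_residual_eq_univ`).

A policy of maximal satisfaction probability almost surely takes only conserving actions, and its
probability of being in an active state at time n tends to 0 (`ae_mem_conserving`,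
`tendsto_measure_active`). Conserving actions alone do not suffice: they may circle among active
states forever, possibly for free. The surcharge δ excludes this, since finite cost then means
finite expected time in active states (`reach_le_measure_exists_good`). The minimal cost is bounded
by some finite B uniformly in δ ≤ 1: no nonempty set of active states is closed under all conserving
actions (`eq_empty_of_closed`), so the active states can be left at a geometric rate
(`exists_minCost_le`).

Following a feasible pair for n steps shows that the minimal surcharged cost is at most its cost
plus nδ plus B times the probability of being active at time n. Letting δ → 0 and then n → ∞, the
infimum of the surcharged costs is below every feasible cost (`exists_surchargedCost`), and a small
enough surcharge gives an ε-optimal design. -/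

/-! ### Residual languages of co-safe formulae -/

namespace ScLTL

variable {AP : Type*}

/-- The infinite word `a w_0 w_1 …`. -/
def wordCons (a : Set AP) (w : ℕ → Set AP) : ℕ → Set AP
  | 0 => a
  | n + 1 => w n

lemma sat_wordCons_succ (φ : ScLTL AP) (a : Set AP) (w : ℕ → Set AP) (k : ℕ) :
    φ.Sat (wordCons a w) (k + 1) ↔ φ.Sat w k := by
  induction φ generalizing k with
  | tt => simp [Sat]
  | atom p => simp [Sat, wordCons]
  | natom p => simp [Sat, wordCons]
  | conj φ ψ h1 h2 => simp [Sat, h1, h2]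
  | disj φ ψ h1 h2 => simp [Sat, h1, h2]
  | next φ h => simp [Sat, h]
  | untl φ ψ h1 h2 =>
    simp only [Sat]
    constructor
    · rintro ⟨j, hj, hψ, hφ⟩
      obtain ⟨j, rfl⟩ : ∃ i, j = i + 1 := ⟨j - 1, by omega⟩
      exact ⟨j, by omega, (h2 j).1 hψ, fun i hi hij => (h1 i).1 (hφ _ (by omega) (by omega))⟩
    · rintro ⟨j, hj, hψ, hφ⟩
      refine ⟨j + 1, by omega, (h2 j).2 hψ, fun i hi hij => ?_⟩
      obtain ⟨i, rfl⟩ : ∃ l, i = l + 1 := ⟨i - 1, by omega⟩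
      exact (h1 i).2 (hφ _ (by omega) (by omega))
  | ev φ h =>
    simp only [Sat]
    constructor
    · rintro ⟨j, hj, hφ⟩
      obtain ⟨j, rfl⟩ : ∃ i, j = i + 1 := ⟨j - 1, by omega⟩
      exact ⟨j, by omega, (h j).1 hφ⟩
    · rintro ⟨j, hj, hφ⟩
      exact ⟨j + 1, by omega, (h j).2 hφ⟩

lemma sat_untl_iff (φ ψ : ScLTL AP) (w : ℕ → Set AP) (k : ℕ) :
    (untl φ ψ).Sat w k ↔ ψ.Sat w k ∨ (φ.Sat w k ∧ (untl φ ψ).Sat w (k + 1)) := by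
  simp only [Sat]
  constructor
  · rintro ⟨j, hj, hψ, hφ⟩
    rcases hj.eq_or_lt with rfl | hlt
    · exact Or.inl hψ
    · exact Or.inr ⟨hφ k le_rfl hlt, j, hlt, hψ, fun i hi hij => hφ i (by omega) hij⟩
  · rintro (h | ⟨h, j, hj, hψ, hφ⟩)
    · exact ⟨k, le_rfl, h, fun i hi hij => by omega⟩
    · refine ⟨j, by omega, hψ, fun i hi hij => ?_⟩
      rcases hi.eq_or_lt with rfl | hlt
      · exact h
      · exact hφ i hlt hij

lemma sat_ev_iff (φ : ScLTL AP) (w : ℕ → Set AP) (k : ℕ) :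
    (ev φ).Sat w k ↔ φ.Sat w k ∨ (ev φ).Sat w (k + 1) := by
  simp only [Sat]
  constructor
  · rintro ⟨j, hj, hφ⟩
    rcases hj.eq_or_lt with rfl | hlt
    · exact Or.inl hφ
    · exact Or.inr ⟨j, hlt, hφ⟩
  · rintro (h | ⟨j, hj, hφ⟩)
    · exact ⟨k, le_rfl, h⟩
    · exact ⟨j, by omega, hφ⟩

/-- The set of the infinite words `w` such that the word `u w` satisfies `φ`. -/
def residual (φ : ScLTL AP) (u : List (Set AP)) : Set (ℕ → Set AP) :=
  {w | Models (u.foldr wordCons w) φ}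

lemma residual_concat (φ : ScLTL AP) (u : List (Set AP)) (a : Set AP) :
    φ.residual (u ++ [a]) = {w | wordCons a w ∈ φ.residual u} := by
  simp [residual]

lemma residual_next_cons (φ : ScLTL AP) (a : Set AP) (u : List (Set AP)) :
    (next φ).residual (a :: u) = φ.residual u := by
  ext w
  exact sat_wordCons_succ φ a _ 0

/-- The expansion law of until. Only the shorter word `u` occurs with the until formula itself, so
an induction on the word stays in the lattice generated by the residuals of the subformulae. -/
lemma residual_untl_cons (φ ψ : ScLTL AP) (a : Set AP) (u : List (Set AP)) :
    (untl φ ψ).residual (a :: u) =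
      ψ.residual (a :: u) ⊔ φ.residual (a :: u) ⊓ (untl φ ψ).residual u := by
  ext w
  refine (sat_untl_iff φ ψ _ 0).trans ?_
  exact or_congr Iff.rfl (and_congr Iff.rfl (sat_wordCons_succ (untl φ ψ) a _ 0))

lemma residual_ev_cons (φ : ScLTL AP) (a : Set AP) (u : List (Set AP)) :
    (ev φ).residual (a :: u) = φ.residual (a :: u) ⊔ (ev φ).residual u := by
  ext w
  refine (sat_ev_iff φ _ 0).trans ?_
  exact or_congr Iff.rfl (sat_wordCons_succ (ev φ) a _ 0)

/-- A co-safe formula has finitely many residual languages. -/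
theorem finite_range_residual (φ : ScLTL AP) : (Set.range φ.residual).Finite := by
  have lit : ∀ ψ : ScLTL AP, (∀ (a : Set AP) (u : List (Set AP)),
      ψ.residual (a :: u) = Set.univ ∨ ψ.residual (a :: u) = ∅) →
      (Set.range ψ.residual).Finite := by
    intro ψ h
    refine (Set.toFinite {ψ.residual [], Set.univ, ∅}).subset ?_
    rintro _ ⟨_ | ⟨a, u⟩, rfl⟩
    · simp
    · rcases h a u with h | h <;> simp [h]
  induction φ with
  | tt => exact lit _ fun a u => Or.inl (by ext w; simp [residual, Models, Sat])
  | atom p =>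
    refine lit _ fun a u => ?_
    by_cases h : p ∈ a
    · exact Or.inl (by ext w; simp [residual, Models, Sat, wordCons, h])
    · exact Or.inr (by ext w; simp [residual, Models, Sat, wordCons, h])
  | natom p =>
    refine lit _ fun a u => ?_
    by_cases h : p ∈ a
    · exact Or.inr (by ext w; simp [residual, Models, Sat, wordCons, h])
    · exact Or.inl (by ext w; simp [residual, Models, Sat, wordCons, h])
  | conj φ ψ h1 h2 =>
    refine (h1.image2 (· ⊓ ·) h2).subset ?_
    rintro _ ⟨u, rfl⟩
    exact ⟨_, ⟨u, rfl⟩, _, ⟨u, rfl⟩, rfl⟩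
  | disj φ ψ h1 h2 =>
    refine (h1.image2 (· ⊔ ·) h2).subset ?_
    rintro _ ⟨u, rfl⟩
    exact ⟨_, ⟨u, rfl⟩, _, ⟨u, rfl⟩, rfl⟩
  | next φ h =>
    refine (h.insert ((next φ).residual [])).subset ?_
    rintro _ ⟨_ | ⟨a, u⟩, rfl⟩
    · simp
    · exact Or.inr ⟨u, (residual_next_cons φ a u).symm⟩
  | untl φ ψ h1 h2 =>
    -- Sets form a distributive lattice, in which finitely many generators have a finite closure.
    refine (((h1.union h2).insert ((untl φ ψ).residual [])).latticeClosure).subset ?_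
    rintro _ ⟨u, rfl⟩
    induction u with
    | nil => exact subset_latticeClosure (Or.inl rfl)
    | cons a u ih =>
      rw [residual_untl_cons]
      refine isSublattice_latticeClosure.supClosed
        (subset_latticeClosure (.inr (.inr (Set.mem_range_self (a :: u)))))
        (isSublattice_latticeClosure.infClosed
          (subset_latticeClosure (.inr (.inl (Set.mem_range_self (a :: u))))) ih)
  | ev φ h =>
    refine ((h.insert ((ev φ).residual [])).latticeClosure).subset ?_
    rintro _ ⟨u, rfl⟩
    induction u with
    | nil => exact subset_latticeClosure (Or.inl rfl)
    | cons a u ih =>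
      rw [residual_ev_cons]
      exact isSublattice_latticeClosure.supClosed
        (subset_latticeClosure (.inr (Set.mem_range_self (a :: u)))) ih

/-- Satisfaction of a co-safe formula is witnessed by a finite prefix. -/
lemma exists_prefix_of_sat (φ : ScLTL AP) {w : ℕ → Set AP} {k : ℕ} (h : φ.Sat w k) :
    ∃ n, ∀ w', (∀ i < n, w' i = w i) → φ.Sat w' k := by
  induction φ generalizing k with
  | tt => exact ⟨0, fun _ _ => trivial⟩
  | atom p => exact ⟨k + 1, fun w' hw => by simpa [Sat, hw k (by omega)] using h⟩
  | natom p => exact ⟨k + 1, fun w' hw => by simpa [Sat, hw k (by omega)] using h⟩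
  | conj φ ψ h1 h2 =>
    obtain ⟨n, hn⟩ := h1 h.1
    obtain ⟨m, hm⟩ := h2 h.2
    exact ⟨max n m, fun w' hw => ⟨hn w' fun i hi => hw i (lt_max_of_lt_left hi),
      hm w' fun i hi => hw i (lt_max_of_lt_right hi)⟩⟩
  | disj φ ψ h1 h2 =>
    rcases h with h | h
    · obtain ⟨n, hn⟩ := h1 h
      exact ⟨n, fun w' hw => Or.inl (hn w' hw)⟩
    · obtain ⟨n, hn⟩ := h2 h
      exact ⟨n, fun w' hw => Or.inr (hn w' hw)⟩
  | next φ h1 => exact h1 (k := k + 1) h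
  | untl φ ψ h1 h2 =>
    obtain ⟨j, hj, hψ, hφ⟩ := h
    obtain ⟨m, hm⟩ := h2 hψ
    have : ∀ i, ∃ n, k ≤ i → i < j → ∀ w', (∀ l < n, w' l = w l) → φ.Sat w' i := by
      intro i
      by_cases hi : k ≤ i ∧ i < j
      · obtain ⟨n, hn⟩ := h1 (hφ i hi.1 hi.2)
        exact ⟨n, fun _ _ => hn⟩
      · exact ⟨0, fun a b => absurd ⟨a, b⟩ hi⟩
    choose n hn using this
    refine ⟨max m ((Finset.range j).sup n), fun w' hw => ⟨j, hj,
      hm w' fun i hi => hw i (lt_max_of_lt_left hi), fun i hi hij => hn i hi hij w' fun l hl =>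
        hw l (lt_max_of_lt_right (hl.trans_le (Finset.le_sup (Finset.mem_range.2 hij))))⟩⟩
  | ev φ h1 =>
    obtain ⟨j, hj, hφ⟩ := h
    obtain ⟨n, hn⟩ := h1 hφ
    exact ⟨n, fun w' hw => ⟨j, hj, hn w' hw⟩⟩

lemma foldr_wordCons_of_lt (u : List (Set AP)) (w : ℕ → Set AP) (i : ℕ) (hi : i < u.length) :
    u.foldr wordCons w i = u[i] := by
  induction u generalizing i with
  | nil => simp at hi
  | cons a u ih =>
    cases i with
    | zero => rfl
    | succ i => simpa [wordCons] using ih i (by simpa using hi)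

lemma foldr_wordCons_length_add (u : List (Set AP)) (w : ℕ → Set AP) (i : ℕ) :
    u.foldr wordCons w (u.length + i) = w i := by
  induction u with
  | nil => simp
  | cons a u ih => simpa [wordCons, Nat.add_right_comm] using ih

lemma foldr_wordCons_ofFn (w : ℕ → Set AP) (n : ℕ) :
    (List.ofFn fun i : Fin n => w i).foldr wordCons (fun i => w (n + i)) = w := by
  ext1 j
  rcases lt_or_ge j n with h | h
  · rw [foldr_wordCons_of_lt _ _ _ (by simpa using h)]
    simp
  · obtain ⟨i, rfl⟩ := Nat.exists_eq_add_of_le h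
    simpa using foldr_wordCons_length_add (List.ofFn fun i : Fin n => w i) (fun i => w (n + i)) i

/-- A word satisfies a co-safe formula if and only if it has a nonempty good prefix. -/
theorem models_iff_exists_residual_eq_univ (φ : ScLTL AP) (w : ℕ → Set AP) :
    Models w φ ↔ ∃ n, φ.residual (List.ofFn fun i : Fin (n + 1) => w i) = Set.univ := by
  constructor
  · intro h
    obtain ⟨n, hn⟩ := φ.exists_prefix_of_sat h
    -- One letter more than needed: prefixes are kept nonempty because a path always contains its
    -- initial state.
    refine ⟨n, Set.eq_univ_of_forall fun w' => hn _ fun i hi => ?_⟩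
    rw [foldr_wordCons_of_lt _ _ _ (by simp; omega), List.getElem_ofFn]
  · rintro ⟨n, hn⟩
    have : (fun i => w (n + 1 + i)) ∈ φ.residual (List.ofFn fun i : Fin (n + 1) => w i) := by
      rw [hn]; trivial
    rwa [residual, Set.mem_ofPred_eq, foldr_wordCons_ofFn] at this

end ScLTL

/-! ### Reachability and minimal cost in finite controlled systems -/

/-- A finite controlled system with a set of target states: in the state `z`, under the action `a`,
a disturbance is drawn from `law z a`, and it determines the next state through `nxt`. -/
structure ReachSystem (Z S A : Type*) where
  avail : Z → Finset A
  avail_nonempty : ∀ z, (avail z).Nonempty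
  law : Z → A → PMF S
  nxt : Z → S → Z
  good : Set Z
  nxt_good : ∀ z ∈ good, ∀ s, nxt z s ∈ good

namespace ReachSystem

variable {Z S A : Type*} [Fintype S] (R : ReachSystem Z S A)

/-- The expectation of `f` at the successor of `z` under `a`. -/
noncomputable def exp (z : Z) (a : A) (f : Z → ℝ≥0∞) : ℝ≥0∞ :=
  ∑ s, R.law z a s * f (R.nxt z s)

lemma sum_law (z : Z) (a : A) : ∑ s, R.law z a s = 1 := by
  rw [← tsum_fintype (L := .unconditional S)]; exact (R.law z a).tsum_coe

lemma exp_mono {z : Z} {a : A} {f g : Z → ℝ≥0∞} (h : ∀ z, f z ≤ g z) :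
    R.exp z a f ≤ R.exp z a g :=
  Finset.sum_le_sum fun _ _ => mul_le_mul_right (h _) _

lemma exp_congr {z : Z} {a : A} {f : Z → ℝ≥0∞} {m : ℝ≥0∞}
    (h : ∀ s, R.law z a s ≠ 0 → f (R.nxt z s) = m) : R.exp z a f = m := by
  have : R.exp z a f = ∑ s, R.law z a s * m := Finset.sum_congr rfl fun s _ => by
    by_cases hs : R.law z a s = 0
    · simp [hs]
    · rw [h s hs]
  rw [this, ← Finset.sum_mul, R.sum_law, one_mul]

lemma exp_le_of_le {z : Z} {a : A} {f : Z → ℝ≥0∞} {m : ℝ≥0∞} (h : ∀ z, f z ≤ m) :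
    R.exp z a f ≤ m :=
  (R.exp_mono (g := fun _ => m) h).trans_eq (R.exp_congr fun _ _ => rfl)

lemma exp_iSup {z : Z} {a : A} {f : ℕ → Z → ℝ≥0∞} (hf : Monotone f) :
    R.exp z a (fun z => ⨆ n, f n z) = ⨆ n, R.exp z a (f n) := by
  unfold exp
  simp_rw [ENNReal.mul_iSup]
  exact ENNReal.finsetSum_iSup_of_monotone fun s n m h => mul_le_mul_right (hf h _) _

lemma exp_const_add (z : Z) (a : A) (c : ℝ≥0∞) (f : Z → ℝ≥0∞) (C : ℝ≥0∞) :
    R.exp z a (fun z => c + f z * C) = c + R.exp z a f * C := by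
  unfold exp
  simp_rw [mul_add, Finset.sum_add_distrib, ← Finset.sum_mul, R.sum_law, one_mul, ← mul_assoc,
    ← Finset.sum_mul]

/-- An average that is at least an upper bound of its terms is attained by all of them. -/
lemma eq_of_le_exp {z : Z} {a : A} {f : Z → ℝ≥0∞} {m : ℝ≥0∞} (hm : m ≠ ∞)
    (hf : ∀ s, R.law z a s ≠ 0 → f (R.nxt z s) ≤ m) (h : m ≤ R.exp z a f) (s : S)
    (hs : R.law z a s ≠ 0) : f (R.nxt z s) = m := by
  -- The bound `m` is the average of `f` plus the average deficit, so the deficit must vanish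
  -- wherever `law` is positive.
  have h1 : m = R.exp z a f + ∑ s, R.law z a s * (m - f (R.nxt z s)) := by
    unfold exp
    rw [← Finset.sum_add_distrib]
    refine (R.exp_congr (f := fun _ => m) (z := z) (a := a) fun _ _ => rfl).symm.trans
      (Finset.sum_congr rfl fun s _ => ?_)
    by_cases hs : R.law z a s = 0
    · simp [hs]
    · rw [← mul_add, add_tsub_cancel_of_le (hf s hs)]
  have h2 : R.exp z a f ≠ ∞ := ne_top_of_le_ne_top hm (h1 ▸ le_self_add)
  have h3 : R.exp z a f + ∑ s, R.law z a s * (m - f (R.nxt z s)) ≤ R.exp z a f + 0 := by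
    rw [← h1, add_zero]; exact h
  have h4 := le_zero_iff.1 ((ENNReal.add_le_add_iff_left h2).1 h3)
  have h5 := (Finset.sum_eq_zero_iff.1 h4) s (Finset.mem_univ s)
  exact le_antisymm (hf s hs) (tsub_eq_zero_iff_le.1 ((mul_eq_zero.1 h5).resolve_left hs))

/-! ### Maximal reachability and conserving actions -/

open Classical in
/-- The maximal probability of reaching the target within `n` steps. -/
noncomputable def reachIn : ℕ → Z → ℝ≥0∞
  | 0 => fun z => if z ∈ R.good then 1 else 0
  | n + 1 => fun z => if z ∈ R.good then 1 else (R.avail z).sup fun a => R.exp z a (reachIn n)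

/-- The maximal probability of reaching the target. -/
noncomputable def reach (z : Z) : ℝ≥0∞ := ⨆ n, R.reachIn n z

lemma reachIn_good {z : Z} (hz : z ∈ R.good) (n : ℕ) : R.reachIn n z = 1 := by
  cases n <;> simp [reachIn, hz]

lemma reachIn_mono : Monotone R.reachIn := by
  refine monotone_nat_of_le_succ fun n => ?_
  induction n with
  | zero =>
    intro z
    by_cases hz : z ∈ R.good
    · rw [R.reachIn_good hz, R.reachIn_good hz]
    · simp [reachIn, hz]
  | succ n ih =>
    intro z
    by_cases hz : z ∈ R.good
    · rw [R.reachIn_good hz, R.reachIn_good hz]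
    · simp only [reachIn, hz, if_false]
      exact Finset.sup_mono_fun fun a _ => R.exp_mono ih

lemma reach_good {z : Z} (hz : z ∈ R.good) : R.reach z = 1 := by
  simp [reach, R.reachIn_good hz]

/-- Value iteration starts below `u` and cannot cross it. This minimality of `reach` is what
`eq_empty_of_closed` plays against a lowered copy of `reach`. -/
lemma reach_le_of_superharmonic {u : Z → ℝ≥0∞} (h1 : ∀ z ∈ R.good, 1 ≤ u z)
    (h2 : ∀ z ∉ R.good, ∀ a ∈ R.avail z, R.exp z a u ≤ u z) (z : Z) : R.reach z ≤ u z := by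
  refine iSup_le fun n => ?_
  induction n generalizing z with
  | zero =>
    by_cases hz : z ∈ R.good
    · rw [R.reachIn_good hz]; exact h1 z hz
    · simp [reachIn, hz]
  | succ n ih =>
    by_cases hz : z ∈ R.good
    · rw [R.reachIn_good hz]; exact h1 z hz
    · simp only [reachIn, hz, if_false]
      exact Finset.sup_le fun a ha => (R.exp_mono ih).trans (h2 z hz a ha)

lemma reach_le_one (z : Z) : R.reach z ≤ 1 :=
  R.reach_le_of_superharmonic (u := fun _ => 1) (fun _ _ => le_rfl)
    (fun _ _ _ _ => R.exp_le_of_le fun _ => le_rfl) z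

lemma reach_ne_top (z : Z) : R.reach z ≠ ∞ :=
  ne_top_of_le_ne_top ENNReal.one_ne_top (R.reach_le_one z)

lemma reach_eq_sup {z : Z} (hz : z ∉ R.good) :
    R.reach z = (R.avail z).sup fun a => R.exp z a R.reach := by
  have h1 : R.reach z = ⨆ n, R.reachIn (n + 1) z :=
    (Monotone.iSup_nat_add (f := fun n => R.reachIn n z) (fun _ _ h => R.reachIn_mono h z) 1).symm
  have h2 : R.reach = fun z => ⨆ n, R.reachIn n z := rfl
  rw [h1, h2]
  simp only [reachIn, hz, if_false, R.exp_iSup R.reachIn_mono, Finset.sup_eq_iSup]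
  rw [iSup_comm]
  exact iSup_congr fun a => iSup_comm

lemma exp_reach_le {z : Z} {a : A} (ha : a ∈ R.avail z) : R.exp z a R.reach ≤ R.reach z := by
  by_cases hz : z ∈ R.good
  · rw [R.reach_good hz]; exact R.exp_le_of_le R.reach_le_one
  · rw [R.reach_eq_sup hz]; exact Finset.le_sup (f := fun a => R.exp z a R.reach) ha

open Classical in
/-- The available actions that preserve the maximal probability of reaching the target. -/
noncomputable def conserving (z : Z) : Finset A :=
  (R.avail z).filter fun a => R.exp z a R.reach = R.reach z

lemma mem_conserving {z : Z} {a : A} :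
    a ∈ R.conserving z ↔ a ∈ R.avail z ∧ R.exp z a R.reach = R.reach z := by
  simp [conserving]

lemma conserving_nonempty {z : Z} (hz : z ∉ R.good) : (R.conserving z).Nonempty := by
  obtain ⟨a, ha, h⟩ := Finset.exists_mem_eq_sup (R.avail z) (R.avail_nonempty z)
    fun a => R.exp z a R.reach
  exact ⟨a, R.mem_conserving.2 ⟨ha, by rw [R.reach_eq_sup hz, h]⟩⟩

/-- The states outside the target from which the target can be reached. -/
def active : Set Z := {z | z ∉ R.good ∧ R.reach z ≠ 0}

/-- The target is absorbing, and where `reach` is 0 it stays 0. Outside the active states nothing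
can be lost, so no incentive is needed there. -/
lemma exp_reach_of_not_active {z : Z} (hz : z ∉ R.active) {a : A} (ha : a ∈ R.avail z) :
    R.exp z a R.reach = R.reach z := by
  by_cases hg : z ∈ R.good
  · rw [R.reach_good hg]
    exact R.exp_congr fun s _ => R.reach_good (R.nxt_good z hg s)
  · have : R.reach z = 0 := by by_contra h; exact hz ⟨hg, h⟩
    rw [this]
    exact le_zero_iff.1 ((R.exp_reach_le ha).trans_eq this)

/-- A set of active states that no conserving action can leave is empty. -/
theorem eq_empty_of_closed [Finite Z] [Finite A] {U : Set Z} (hU : U ⊆ R.active)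
    (hc : ∀ z ∈ U, ∀ a ∈ R.conserving z, ∀ s, R.law z a s ≠ 0 → R.nxt z s ∈ U) : U = ∅ := by
  classical
  by_contra hne
  obtain ⟨z₀, hz₀, hmax⟩ := Set.exists_max_image U R.reach U.toFinite
    (Set.nonempty_iff_ne_empty.2 hne)
  set m := R.reach z₀ with hm
  have hmpos : 0 < m := pos_iff_ne_zero.2 (hU hz₀).2
  cases nonempty_fintype Z
  cases nonempty_fintype A
  -- The largest one-step expectation strictly below `m`, or 0 if there is none; finiteness keeps it
  -- strictly below `m`.
  set m' : ℝ≥0∞ := Finset.univ.sup fun x : Z × A =>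
    if R.exp x.1 x.2 R.reach < m then R.exp x.1 x.2 R.reach else 0 with hm'
  have hlt : m' < m := by
    refine (Finset.sup_lt_iff (by simpa using hmpos)).2 fun x _ => ?_
    split_ifs with h
    · exact h
    · exact hmpos
  -- Lowering `reach` to `m'` where it attains its maximum on `U` leaves it superharmonic, against
  -- the minimality of `reach` at `z₀`.
  set u : Z → ℝ≥0∞ := fun z => if z ∈ U ∧ R.reach z = m then m' else R.reach z with hu
  have huv : ∀ z, u z ≤ R.reach z := by
    intro z
    simp only [hu]
    split_ifs with h
    · rw [h.2]; exact hlt.le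
    · exact le_rfl
  have key := R.reach_le_of_superharmonic (u := u) (fun z hz => by
      have : ¬ (z ∈ U ∧ R.reach z = m) := fun h => (hU h.1).1 hz
      simp only [hu, this, if_false]; exact (R.reach_good hz).ge) (fun z _ a ha => by
      by_cases h : z ∈ U ∧ R.reach z = m
      · have huz : u z = m' := by simp only [hu]; rw [if_pos h]
        rw [huz]
        rcases (R.exp_reach_le ha).lt_or_eq with hl | he
        · rw [h.2] at hl
          refine (R.exp_mono huv).trans ?_
          have := Finset.le_sup (f := fun x : Z × A =>
            if R.exp x.1 x.2 R.reach < m then R.exp x.1 x.2 R.reach else 0)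
            (Finset.mem_univ (z, a))
          simpa only [hl, if_true] using this
        -- A conserving action stays in `U`, where `reach` is at most `m`. Its average is `m`, so
        -- every possible successor attains `m` and was lowered too.
        · have hac : a ∈ R.conserving z := R.mem_conserving.2 ⟨ha, he⟩
          refine (R.exp_congr fun s hs => ?_).le
          have h1 := hc z h.1 a hac
          have h2 := R.eq_of_le_exp (R.reach_ne_top z₀) (fun s hs => hmax _ (h1 s hs))
            (he.trans h.2).ge s hs
          simp only [hu]
          rw [if_pos ⟨h1 s hs, h2⟩]
      · have huz : u z = R.reach z := by simp only [hu]; rw [if_neg h]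
        rw [huz]
        exact (R.exp_mono huv).trans (R.exp_reach_le ha)) z₀
  have : u z₀ = m' := by simp only [hu]; rw [if_pos ⟨hz₀, rfl⟩]
  rw [this] at key
  exact absurd hlt (not_lt.2 key)

/-! ### Leaving the active states -/

open Classical in
/-- The minimal probability, over the conserving actions, of being in active states for `n`
steps. -/
noncomputable def survive : ℕ → Z → ℝ≥0∞
  | 0 => fun z => if z ∈ R.active then 1 else 0
  | n + 1 => fun z =>
      if z ∈ R.active then (R.conserving z).inf fun a => R.exp z a (survive n) else 0

lemma survive_succ {z : Z} (hz : z ∈ R.active) (n : ℕ) :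
    R.survive (n + 1) z = (R.conserving z).inf fun a => R.exp z a (R.survive n) := by
  simp [survive, hz]

lemma survive_le_one (n : ℕ) (z : Z) : R.survive n z ≤ 1 := by
  induction n generalizing z with
  | zero => simp only [survive]; split_ifs <;> simp
  | succ n ih =>
    simp only [survive]
    split_ifs with h
    · obtain ⟨a, ha⟩ := R.conserving_nonempty h.1
      exact (Finset.inf_le ha).trans (R.exp_le_of_le ih)
    · simp

lemma survive_antitone : Antitone R.survive := by
  refine antitone_nat_of_succ_le fun n => ?_
  induction n with
  | zero =>
    intro z
    by_cases h : z ∈ R.active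
    · simpa [survive, h] using R.survive_le_one 1 z
    · simp [survive, h]
  | succ n ih =>
    intro z
    by_cases h : z ∈ R.active
    · rw [R.survive_succ h, R.survive_succ h]
      exact Finset.inf_mono_fun fun a _ => R.exp_mono ih
    · simp [survive, h]

/-- If the minimal survival probability is 1 at every horizon, each conserving action leads only to
states with the same property. Such states form a closed set, which is empty by
`eq_empty_of_closed`; finiteness and monotonicity then give a common horizon. -/
theorem exists_survive_le [Finite Z] [Finite A] :
    ∃ (N : ℕ) (q : ℝ≥0∞), q < 1 ∧ ∀ z, R.survive N z ≤ q := by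
  have h1 : {z | ∀ n, 1 ≤ R.survive n z} = ∅ := by
    refine R.eq_empty_of_closed (fun z hz => ?_) fun z hz a ha s hs n => ?_
    · by_contra h
      simpa [survive, h] using hz 0
    · have hact : z ∈ R.active := by
        by_contra h
        simpa [survive, h] using hz 0
      have h2 := hz (n + 1)
      rw [R.survive_succ hact] at h2
      exact (R.eq_of_le_exp ENNReal.one_ne_top (fun s _ => R.survive_le_one n _)
        (h2.trans (Finset.inf_le ha)) s hs).ge
  have h2 : ∀ z, ∃ n, R.survive n z < 1 := fun z => by
    by_contra! h
    exact (Set.eq_empty_iff_forall_notMem.1 h1) z h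
  choose n hn using h2
  cases nonempty_fintype Z
  refine ⟨Finset.univ.sup n, Finset.univ.sup (R.survive (Finset.univ.sup n)),
    (Finset.sup_lt_iff (by simp)).2 fun z _ => ?_, fun z => Finset.le_sup (Finset.mem_univ z)⟩
  exact (R.survive_antitone (Finset.le_sup (Finset.mem_univ z)) z).trans_lt (hn z)

/-! ### Minimal expected cost over conserving actions -/

variable (k : Z → A → ℝ≥0∞)

open Classical in
/-- The minimal expected cost of `n` steps, over the conserving actions, when `k z a` is paid for
the action `a` in the active state `z`. -/
noncomputable def minCostIn : ℕ → Z → ℝ≥0∞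
  | 0 => fun _ => 0
  | n + 1 => fun z =>
      if z ∈ R.active then (R.conserving z).inf fun a => k z a + R.exp z a (minCostIn n) else 0

/-- The minimal expected total cost over the conserving actions, when `k z a` is paid for the
action `a` in the active state `z`. -/
noncomputable def minCost (z : Z) : ℝ≥0∞ := ⨆ n, R.minCostIn k n z

lemma minCostIn_succ {z : Z} (hz : z ∈ R.active) (n : ℕ) :
    R.minCostIn k (n + 1) z =
      (R.conserving z).inf fun a => k z a + R.exp z a (R.minCostIn k n) := by
  simp [minCostIn, hz]

lemma minCostIn_of_not_active {z : Z} (hz : z ∉ R.active) (n : ℕ) : R.minCostIn k n z = 0 := by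
  cases n <;> simp [minCostIn, hz]

lemma minCostIn_mono : Monotone (R.minCostIn k) := by
  refine monotone_nat_of_le_succ fun n => ?_
  induction n with
  | zero => intro z; simp [minCostIn]
  | succ n ih =>
    intro z
    by_cases h : z ∈ R.active
    · rw [R.minCostIn_succ k h, R.minCostIn_succ k h]
      exact Finset.inf_mono_fun fun a _ => add_le_add le_rfl (R.exp_mono ih)
    · rw [R.minCostIn_of_not_active k h, R.minCostIn_of_not_active k h]

lemma minCostIn_le_minCost (n : ℕ) (z : Z) : R.minCostIn k n z ≤ R.minCost k z :=
  le_iSup (fun n => R.minCostIn k n z) n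

lemma minCost_of_not_active {z : Z} (hz : z ∉ R.active) : R.minCost k z = 0 := by
  exact le_zero_iff.1 (iSup_le fun n => (R.minCostIn_of_not_active k hz n).le)

lemma exp_minCost_of_not_active {z : Z} (hz : z ∉ R.active) {a : A} (ha : a ∈ R.avail z) :
    R.exp z a (R.minCost k) = 0 := by
  refine R.exp_congr fun s hs => R.minCost_of_not_active k fun hact => ?_
  by_cases hg : z ∈ R.good
  · exact hact.1 (R.nxt_good z hg s)
  · have h0 : R.reach z = 0 := by by_contra h; exact hz ⟨hg, h⟩
    have h1 := R.exp_reach_of_not_active hz ha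
    rw [h0] at h1
    exact hact.2
      ((mul_eq_zero.1 (Finset.sum_eq_zero_iff.1 h1 s (Finset.mem_univ s))).resolve_left hs)

lemma minCost_le {z : Z} {a : A} (ha : a ∈ R.conserving z) :
    R.minCost k z ≤ k z a + R.exp z a (R.minCost k) := by
  refine iSup_le fun n => ?_
  cases n with
  | zero => simp [minCostIn]
  | succ n =>
    by_cases h : z ∈ R.active
    · rw [R.minCostIn_succ k h]
      exact (Finset.inf_le ha).trans
        (add_le_add le_rfl (R.exp_mono (R.minCostIn_le_minCost k n)))
    · simp [R.minCostIn_of_not_active k h]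

/-- The minimum over finitely many actions commutes with the increasing limit in the horizon, so one
action is optimal for all horizons at once in the limit. -/
lemma exists_le_minCost {z : Z} (hz : z ∈ R.active) :
    ∃ a ∈ R.conserving z, k z a + R.exp z a (R.minCost k) ≤ R.minCost k z := by
  obtain ⟨a, ha, h⟩ := Finset.exists_mem_eq_inf (R.conserving z) (R.conserving_nonempty hz.1)
    fun a => k z a + R.exp z a (R.minCost k)
  refine ⟨a, ha, ?_⟩
  rw [← h]
  have h1 : ∀ a, k z a + R.exp z a (R.minCost k) = ⨆ n, (k z a + R.exp z a (R.minCostIn k n)) := by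
    intro a
    rw [← ENNReal.add_iSup, ← R.exp_iSup (R.minCostIn_mono k)]
    rfl
  have h2 : R.minCost k z = ⨆ n, R.minCostIn k (n + 1) z :=
    (Monotone.iSup_nat_add (f := fun n => R.minCostIn k n z)
      (fun _ _ h => R.minCostIn_mono k h z) 1).symm
  simp_rw [h2, R.minCostIn_succ k hz, h1, Finset.inf_eq_iInf, iInf_subtype']
  rw [iSup_iInf_of_monotone]
  exact fun a n m h => add_le_add le_rfl (R.exp_mono (R.minCostIn_mono k h))

/-- The minimal cost is bounded uniformly in the cost function. -/
theorem exists_minCost_le [Finite Z] [Finite A] {K : ℝ≥0∞} (hK : K ≠ ∞) :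
    ∃ B ≠ ∞, ∀ k : Z → A → ℝ≥0∞, (∀ z a, k z a ≤ K) → ∀ z, R.minCost k z ≤ B := by
  obtain ⟨N, q, hq, hN⟩ := R.exists_survive_le
  -- The bound solves `C = N * K + q * C`.
  refine ⟨N * K / (1 - q), ENNReal.div_ne_top (ENNReal.mul_ne_top (by simp) hK)
    (tsub_pos_of_lt hq).ne', fun k hk z => ?_⟩
  -- Minimize survival for `j` steps at price at most `K` each; the remaining cost `C` is incurred
  -- only on survival.
  have step : ∀ (n : ℕ) (C : ℝ≥0∞), (∀ z, R.minCostIn k n z ≤ C) → ∀ j z,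
      R.minCostIn k (n + j) z ≤ j * K + R.survive j z * C := by
    intro n C hC j
    induction j with
    | zero =>
      intro z
      by_cases h : z ∈ R.active
      · simpa [survive, h] using hC z
      · simp [R.minCostIn_of_not_active k h]
    | succ j ih =>
      intro z
      rw [← add_assoc]
      by_cases h : z ∈ R.active
      · rw [R.minCostIn_succ k h, R.survive_succ h]
        obtain ⟨a, ha, hae⟩ := Finset.exists_mem_eq_inf (R.conserving z)
          (R.conserving_nonempty h.1) fun a => R.exp z a (R.survive j)
        rw [hae]
        refine (Finset.inf_le ha).trans ((add_le_add (hk z a) (R.exp_mono ih)).trans_eq ?_)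
        rw [R.exp_const_add]
        push_cast
        ring
      · simp [R.minCostIn_of_not_active k h]
  -- This crude bound only ensures that `C` is finite, so that `q * C` may be subtracted.
  have fin : ∀ n z, R.minCostIn k n z ≤ n * K := fun n z => by
    simpa [minCostIn] using step 0 0 (fun z => by simp [minCostIn]) n z
  cases nonempty_fintype Z
  refine iSup_le fun n => ?_
  set C := Finset.univ.sup (R.minCostIn k n) with hC
  have hle : ∀ z, R.minCostIn k n z ≤ C := fun z => Finset.le_sup (Finset.mem_univ z)
  have hCt : C ≠ ∞ := ne_top_of_le_ne_top (b := n * K) (ENNReal.mul_ne_top (by simp) hK)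
    (Finset.sup_le fun z _ => fin n z)
  have h1 : C ≤ N * K + q * C := Finset.sup_le fun z _ =>
    (R.minCostIn_mono k (Nat.le_add_right n N) z).trans
      ((step n C hle N z).trans (add_le_add le_rfl (mul_le_mul_left (hN z) _)))
  refine (hle z).trans ?_
  rw [ENNReal.le_div_iff_mul_le (Or.inl (tsub_pos_of_lt hq).ne') (Or.inl (by simp)),
    ENNReal.mul_sub (fun _ _ => hCt), mul_one, tsub_le_iff_right, mul_comm C q]
  exact h1

end ReachSystem

/-! ### Random runs: attaining maximal reachability and comparing costs -/

namespace ReachSystem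

open Filter Topology

variable {Z S A : Type*} [Fintype S]

/-- `X` and `α` are the states and the actions of a run of the system `R` started in `z₀`. -/
structure IsRun (R : ReachSystem Z S A) {Ω : Type*} [MeasurableSpace Ω] (μ : Measure Ω) (z₀ : Z)
    (X : ℕ → Ω → Z) (α : ℕ → Ω → A) : Prop where
  meas : ∀ t (f : Z → A → ℝ≥0∞), Measurable fun ω => f (X t ω) (α t ω)
  init : ∀ᵐ ω ∂μ, X 0 ω = z₀
  mem_avail : ∀ᵐ ω ∂μ, ∀ t, α t ω ∈ R.avail (X t ω)
  step : ∀ t (f : Z → ℝ≥0∞), ∫⁻ ω, f (X (t + 1) ω) ∂μ = ∫⁻ ω, R.exp (X t ω) (α t ω) f ∂μ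
  good_succ : ∀ t ω, X t ω ∈ R.good → X (t + 1) ω ∈ R.good

namespace IsRun

variable {R : ReachSystem Z S A} {Ω : Type*} [MeasurableSpace Ω] {μ : Measure Ω}
  {z₀ : Z} {X : ℕ → Ω → Z} {α : ℕ → Ω → A}

lemma measurableSet (h : R.IsRun μ z₀ X α) (t : ℕ) (s : Set Z) :
    MeasurableSet {ω | X t ω ∈ s} := by
  classical
  have := (h.meas t fun z _ => if z ∈ s then 1 else 0) (measurableSet_singleton 1)
  convert this using 1
  ext ω
  simp

lemma lintegral_indicator (h : R.IsRun μ z₀ X α) (t : ℕ) (s : Set Z) :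
    ∫⁻ ω, s.indicator 1 (X t ω) ∂μ = μ {ω | X t ω ∈ s} := by
  rw [← lintegral_indicator_one (h.measurableSet t s)]
  rfl

lemma lintegral_reach_antitone (h : R.IsRun μ z₀ X α) :
    Antitone fun t => ∫⁻ ω, R.reach (X t ω) ∂μ :=
  antitone_nat_of_succ_le fun t => (h.step t _).trans_le
    (lintegral_mono_ae (h.mem_avail.mono fun _ hω => R.exp_reach_le (hω t)))

lemma good_monotone (h : R.IsRun μ z₀ X α) : Monotone fun t => {ω | X t ω ∈ R.good} :=
  monotone_nat_of_le_succ fun t ω hω => h.good_succ t ω hω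

lemma measure_good_le (h : R.IsRun μ z₀ X α) (t : ℕ) :
    μ {ω | X t ω ∈ R.good} ≤ ∫⁻ ω, R.reach (X t ω) ∂μ := by
  rw [← h.lintegral_indicator]
  refine lintegral_mono fun ω => Set.indicator_le (fun z hz => ?_) _
  exact (R.reach_good hz).ge

lemma tendsto_measure_good (h : R.IsRun μ z₀ X α) :
    Tendsto (fun t => μ {ω | X t ω ∈ R.good}) atTop (𝓝 (μ {ω | ∃ t, X t ω ∈ R.good})) := by
  rw [Set.ofPred_exists]
  exact tendsto_measure_iUnion_atTop h.good_monotone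

variable [IsProbabilityMeasure μ]

lemma lintegral_zero (h : R.IsRun μ z₀ X α) (f : Z → ℝ≥0∞) : ∫⁻ ω, f (X 0 ω) ∂μ = f z₀ := by
  rw [lintegral_congr_ae (g := fun _ => f z₀) (h.init.mono fun ω hω => by simp only [hω])]
  simp

lemma lintegral_reach_le (h : R.IsRun μ z₀ X α) (t : ℕ) :
    ∫⁻ ω, R.reach (X t ω) ∂μ ≤ R.reach z₀ :=
  (h.lintegral_reach_antitone (Nat.zero_le t)).trans_eq (h.lintegral_zero _)

/-- The target is reached with probability at most `R.reach z₀`. -/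
theorem measure_exists_good_le (h : R.IsRun μ z₀ X α) :
    μ {ω | ∃ t, X t ω ∈ R.good} ≤ R.reach z₀ :=
  le_of_tendsto' h.tendsto_measure_good fun t => (h.measure_good_le t).trans (h.lintegral_reach_le t)

/-- The expectation of `reach` decreases from `reach z₀`, yet always dominates the probability of
ever reaching the target. -/
lemma lintegral_reach_eq (h : R.IsRun μ z₀ X α)
    (hmax : R.reach z₀ ≤ μ {ω | ∃ t, X t ω ∈ R.good}) (t : ℕ) :
    ∫⁻ ω, R.reach (X t ω) ∂μ = R.reach z₀ := by
  refine le_antisymm (h.lintegral_reach_le t) (hmax.trans ?_)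
  refine le_of_tendsto h.tendsto_measure_good ((eventually_ge_atTop t).mono fun n hn => ?_)
  exact (h.measure_good_le n).trans (h.lintegral_reach_antitone hn)

/-- A run that reaches the target with maximal probability takes conserving actions. -/
theorem ae_mem_conserving (h : R.IsRun μ z₀ X α)
    (hmax : R.reach z₀ ≤ μ {ω | ∃ t, X t ω ∈ R.good}) :
    ∀ᵐ ω ∂μ, ∀ t, α t ω ∈ R.conserving (X t ω) := by
  refine ae_all_iff.2 fun t => ?_
  have h1 : ∀ᵐ ω ∂μ, R.exp (X t ω) (α t ω) R.reach ≤ R.reach (X t ω) :=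
    h.mem_avail.mono fun _ hω => R.exp_reach_le (hω t)
  -- A pointwise inequality between functions of equal finite integral is an almost sure equality.
  have h2 := ae_eq_of_ae_le_of_lintegral_le h1
    (by rw [← h.step, h.lintegral_reach_eq hmax]; exact R.reach_ne_top z₀)
    (h.meas t fun z _ => R.reach z).aemeasurable
    (by rw [← h.step, h.lintegral_reach_eq hmax, h.lintegral_reach_eq hmax])
  filter_upwards [h2, h.mem_avail] with ω h3 h4
  exact R.mem_conserving.2 ⟨h4 t, h3⟩

/-- A run that reaches the target with maximal probability leaves the active states. -/
theorem tendsto_measure_active [Finite Z] (h : R.IsRun μ z₀ X α)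
    (hmax : R.reach z₀ ≤ μ {ω | ∃ t, X t ω ∈ R.good}) :
    Tendsto (fun t => μ {ω | X t ω ∈ R.active}) atTop (𝓝 0) := by
  classical
  cases nonempty_fintype Z
  obtain ⟨m, hm0, hm1, hm⟩ : ∃ m : ℝ≥0∞, m ≠ 0 ∧ m ≠ ∞ ∧ ∀ z ∈ R.active, m ≤ R.reach z := by
    -- The cap 1 keeps `m` finite when no state is active and the infimum is ∞.
    refine ⟨min 1 ((Finset.univ.filter (· ∈ R.active)).inf R.reach), ?_, by simp, fun z hz =>
      (min_le_right _ _).trans (Finset.inf_le (by simpa using hz))⟩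
    refine (lt_min one_pos ?_).ne'
    rw [Finset.lt_inf_iff (by simp)]
    intro z hz
    exact pos_iff_ne_zero.2 (by simpa using hz : z ∈ R.active).2
  -- The indicator of the target plus `m` times that of the active states is at most `reach`.
  have key : ∀ t, m * μ {ω | X t ω ∈ R.active} ≤ R.reach z₀ - μ {ω | X t ω ∈ R.good} := by
    intro t
    refine ENNReal.le_sub_of_add_le_right (measure_ne_top _ _) ?_
    rw [← h.lintegral_indicator, ← h.lintegral_indicator, ← lintegral_const_mul,
      ← lintegral_add_left]
    · refine (lintegral_mono fun ω => ?_).trans (h.lintegral_reach_le t)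
      by_cases hg : X t ω ∈ R.good
      · have ha : X t ω ∉ R.active := fun ha => ha.1 hg
        simp [hg, ha, R.reach_good hg]
      · by_cases ha : X t ω ∈ R.active
        · simpa [hg, ha] using hm _ ha
        · simp [hg, ha]
    · exact h.meas t fun z _ => m * R.active.indicator 1 z
    · exact h.meas t fun z _ => R.active.indicator 1 z
  have h1 : Tendsto (fun t => R.reach z₀ - μ {ω | X t ω ∈ R.good}) atTop (𝓝 0) := by
    have := ENNReal.Tendsto.sub (tendsto_const_nhds (x := R.reach z₀)) h.tendsto_measure_good
      (Or.inl (R.reach_ne_top z₀))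
    rwa [tsub_eq_zero_of_le hmax] at this
  have h2 : Tendsto (fun t => m⁻¹ * (R.reach z₀ - μ {ω | X t ω ∈ R.good})) atTop (𝓝 0) := by
    simpa using ENNReal.Tendsto.const_mul h1 (Or.inr (ENNReal.inv_ne_top.2 hm0))
  refine tendsto_of_tendsto_of_tendsto_of_le_of_le tendsto_const_nhds h2 (fun _ => zero_le)
    fun t => ?_
  rw [mul_comm, ← div_eq_mul_inv, ENNReal.le_div_iff_mul_le (Or.inl hm0) (Or.inl hm1), mul_comm]
  exact key t

lemma minCost_le_sum (h : R.IsRun μ z₀ X α) (k : Z → A → ℝ≥0∞)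
    (hc : ∀ᵐ ω ∂μ, ∀ t, α t ω ∈ R.conserving (X t ω)) (n : ℕ) :
    R.minCost k z₀ ≤ ∑ t ∈ Finset.range n, ∫⁻ ω, k (X t ω) (α t ω) ∂μ +
      ∫⁻ ω, R.minCost k (X n ω) ∂μ := by
  induction n with
  | zero => simp [h.lintegral_zero]
  | succ n ih =>
    refine ih.trans ?_
    rw [Finset.sum_range_succ, add_assoc]
    refine add_le_add le_rfl ?_
    rw [h.step, ← lintegral_add_left (h.meas n k)]
    exact lintegral_mono_ae (hc.mono fun ω hω => R.minCost_le k (hω n))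

/-- For the cost `c + δ` per step, the minimal cost is bounded by the cost of a run that reaches
the target with maximal probability, the surcharge `δ` for `n` steps, and the cost that can be
incurred after `n` steps. -/
theorem minCost_add_const_le (h : R.IsRun μ z₀ X α) (c : Z → A → ℝ≥0∞) (δ B : ℝ≥0∞)
    (hB : ∀ z, R.minCost (fun z a => c z a + δ) z ≤ B)
    (hmax : R.reach z₀ ≤ μ {ω | ∃ t, X t ω ∈ R.good}) (n : ℕ) :
    R.minCost (fun z a => c z a + δ) z₀ ≤
      ∑' t, ∫⁻ ω, c (X t ω) (α t ω) ∂μ + n * δ + B * μ {ω | X n ω ∈ R.active} := by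
  refine (h.minCost_le_sum _ (h.ae_mem_conserving hmax) n).trans (add_le_add ?_ ?_)
  · have : ∀ t, ∫⁻ ω, c (X t ω) (α t ω) + δ ∂μ = ∫⁻ ω, c (X t ω) (α t ω) ∂μ + δ := fun t => by
      rw [lintegral_add_left (h.meas t c)]; simp
    simp_rw [this, Finset.sum_add_distrib]
    refine add_le_add (ENNReal.sum_le_tsum _) (by simp)
  · rw [← h.lintegral_indicator, ← lintegral_const_mul _ (h.meas n fun z _ => R.active.indicator 1 z)]
    refine lintegral_mono fun ω => ?_
    by_cases ha : X n ω ∈ R.active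
    · simpa [ha] using hB _
    · simp [ha, R.minCost_of_not_active _ ha]

open Classical in
/-- The cost of a run that uses minimizing actions is at most the minimal cost. -/
theorem tsum_lintegral_le_minCost (h : R.IsRun μ z₀ X α) (k : Z → A → ℝ≥0∞)
    (hα : ∀ᵐ ω ∂μ, ∀ t, X t ω ∈ R.active →
      k (X t ω) (α t ω) + R.exp (X t ω) (α t ω) (R.minCost k) ≤ R.minCost k (X t ω)) :
    ∑' t, ∫⁻ ω, (if X t ω ∈ R.active then k (X t ω) (α t ω) else 0) ∂μ ≤ R.minCost k z₀ := by
  rw [ENNReal.tsum_eq_iSup_nat]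
  refine iSup_le fun n => ?_
  -- Keeping the expected cost still to come makes the induction telescope.
  suffices H : ∑ t ∈ Finset.range n,
      ∫⁻ ω, (if X t ω ∈ R.active then k (X t ω) (α t ω) else 0) ∂μ +
        ∫⁻ ω, R.minCost k (X n ω) ∂μ ≤ R.minCost k z₀ from le_self_add.trans H
  induction n with
  | zero => simp [h.lintegral_zero]
  | succ n ih =>
    refine le_trans ?_ ih
    rw [Finset.sum_range_succ, add_assoc]
    refine add_le_add le_rfl ?_
    rw [h.step, ← lintegral_add_left (h.meas n fun z a => if z ∈ R.active then k z a else 0)]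
    refine lintegral_mono_ae ?_
    filter_upwards [hα, h.mem_avail] with ω h1 h2
    by_cases ha : X n ω ∈ R.active
    · simpa [ha] using h1 n ha
    · simp [ha, R.exp_minCost_of_not_active k ha (h2 n)]

open Classical in
/-- A run that uses conserving actions and has finite cost, where the cost per step is bounded
away from zero, reaches the target with maximal probability. -/
theorem reach_le_measure_exists_good (h : R.IsRun μ z₀ X α) {k : Z → A → ℝ≥0∞} {δ : ℝ≥0∞}
    (hδ : δ ≠ 0) (hk : ∀ z a, δ ≤ k z a)
    (hc : ∀ᵐ ω ∂μ, ∀ t, X t ω ∈ R.active → α t ω ∈ R.conserving (X t ω))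
    (hfin : ∑' t, ∫⁻ ω, (if X t ω ∈ R.active then k (X t ω) (α t ω) else 0) ∂μ ≠ ∞) :
    R.reach z₀ ≤ μ {ω | ∃ t, X t ω ∈ R.good} := by
  have h1 : ∀ t, ∫⁻ ω, R.reach (X t ω) ∂μ = R.reach z₀ := by
    intro t
    induction t with
    | zero => exact h.lintegral_zero _
    | succ t ih =>
      rw [h.step, ← ih]
      refine lintegral_congr_ae ?_
      filter_upwards [hc, h.mem_avail] with ω h1 h2
      by_cases ha : X t ω ∈ R.active
      · exact (R.mem_conserving.1 (h1 t ha)).2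
      · exact R.exp_reach_of_not_active ha (h2 t)
  have h2 : ∑' t, δ * μ {ω | X t ω ∈ R.active} ≠ ∞ := by
    refine ne_top_of_le_ne_top hfin (ENNReal.tsum_le_tsum fun t => ?_)
    rw [← h.lintegral_indicator,
      ← lintegral_const_mul _ (h.meas t fun z _ => R.active.indicator 1 z)]
    refine lintegral_mono fun ω => ?_
    by_cases ha : X t ω ∈ R.active
    · simpa [ha] using hk _ _
    · simp [ha]
  rw [ENNReal.tsum_mul_left] at h2
  -- The expected time in active states is finite, being at most the cost divided by δ. In the limit
  -- all of `reach` is carried by the target.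
  have h3 : Tendsto (fun t => μ {ω | X t ω ∈ R.active}) atTop (𝓝 0) :=
    ENNReal.tendsto_atTop_zero_of_tsum_ne_top fun h => h2 (by rw [h, ENNReal.mul_top hδ])
  have h4 := h.tendsto_measure_good.add h3
  rw [add_zero] at h4
  refine ge_of_tendsto' h4 fun t => ?_
  rw [← h1 t, ← h.lintegral_indicator, ← h.lintegral_indicator,
    ← lintegral_add_left (h.meas t fun z _ => R.good.indicator 1 z)]
  refine lintegral_mono fun ω => ?_
  by_cases hg : X t ω ∈ R.good
  · simp [hg, R.reach_good hg]
  · by_cases ha : X t ω ∈ R.active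
    · simpa [hg, ha] using R.reach_le_one _
    · have : R.reach (X t ω) = 0 := by by_contra h; exact ha ⟨hg, h⟩
      simp [this]

end IsRun

end ReachSystem

/-! ### The law of the paths -/

lemma PMF.lintegral_toMeasure_fintype {X : Type*} [Fintype X] [MeasurableSpace X]
    [MeasurableSingletonClass X] (p : PMF X) (f : X → ℝ≥0∞) :
    ∫⁻ x, f x ∂p.toMeasure = ∑ x, p x * f x := by
  rw [lintegral_fintype]
  exact Finset.sum_congr rfl fun x _ => by
    rw [p.toMeasure_apply_singleton x (measurableSet_singleton x), mul_comm]

namespace FinMDP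

lemma pathTo_succ {S A : Type*} (ω : ℕ → S × A) (n : ℕ) :
    pathTo ω (n + 1) = pathTo ω n ++ [(ω (n + 1)).1] := by
  rw [pathTo, List.ofFn_succ', List.concat_eq_append]
  rfl

/-! ### The product with the residual automaton -/

section Product

variable {S A AP : Type*} [Fintype S]

/-- The product of `M` with the automaton of the residual languages of `φ`. -/
noncomputable def product (M : FinMDP S A AP) (φ : ScLTL AP) :
    ReachSystem (S × Set.range φ.residual) S A where
  avail z := M.avail z.1
  avail_nonempty z := M.avail_nonempty z.1
  law z a := M.stepPMF z.1 a
  -- The next residual depends only on the current residual language, not on the word `u` that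
  -- produced it.
  nxt z s := (s, ⟨{w | ScLTL.wordCons (M.label s) w ∈ z.2.1}, by
    obtain ⟨_, u, rfl⟩ := z.2
    exact ⟨u ++ [M.label s], φ.residual_concat u _⟩⟩)
  good := {z | z.2.1 = Set.univ}
  nxt_good z hz s := by
    change _ = _ at hz
    change {w | ScLTL.wordCons (M.label s) w ∈ z.2.1} = Set.univ
    rw [hz]; rfl

/-- The residual language of `φ` after the path fragment `h`. -/
def residualAfter (M : FinMDP S A AP) (φ : ScLTL AP) (h : List S) : Set.range φ.residual :=
  ⟨φ.residual (h.map M.label), Set.mem_range_self _⟩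

/-- The state of the product at time `t` along the path `ω`. -/
def productState (M : FinMDP S A AP) (φ : ScLTL AP) (t : ℕ) (ω : ℕ → S × A) :
    S × Set.range φ.residual :=
  ((ω t).1, M.residualAfter φ (pathTo ω t))

lemma product_nxt (M : FinMDP S A AP) (φ : ScLTL AP) (s s' : S) (h : List S) :
    (M.product φ).nxt (s, M.residualAfter φ h) s' = (s', M.residualAfter φ (h ++ [s'])) := by
  refine Prod.ext rfl (Subtype.ext ?_)
  simp only [residualAfter, List.map_append, List.map_cons, List.map_nil, ScLTL.residual_concat]
  rfl

lemma productState_succ (M : FinMDP S A AP) (φ : ScLTL AP) (t : ℕ) (ω : ℕ → S × A) :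
    M.productState φ (t + 1) ω = (M.product φ).nxt (M.productState φ t ω) (ω (t + 1)).1 := by
  rw [productState, productState, product_nxt, pathTo_succ]

lemma models_iff_exists_good (M : FinMDP S A AP) (φ : ScLTL AP) (ω : ℕ → S × A) :
    ScLTL.Models (fun t => M.label (ω t).1) φ ↔
      ∃ t, M.productState φ t ω ∈ (M.product φ).good := by
  rw [ScLTL.models_iff_exists_residual_eq_univ]
  refine exists_congr fun t => ?_
  have : (pathTo ω t).map M.label = List.ofFn fun i : Fin (t + 1) => M.label (ω i).1 := by
    rw [pathTo, List.map_ofFn]; rfl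
  rw [← this]
  rfl

end Product

section Rule

variable {S A AP : Type*} [Fintype S]

lemma mem_avail_of_prob_ne_zero {M : FinMDP S A AP} {d : M.DecisionRule} {s : S} {a : A}
    (h : d.prob s a ≠ 0) : a ∈ M.avail s := by
  by_contra ha
  exact h (d.eq_zero s a ha)

variable [Fintype A]

lemma DecisionRule.toPMF_apply {M : FinMDP S A AP} (d : M.DecisionRule) (s : S) (a : A) :
    d.toPMF s a = ENNReal.ofReal (d.prob s a) := rfl

lemma DecisionRule.sum_toPMF_mul {M : FinMDP S A AP} (d : M.DecisionRule) (s : S) (c : ℝ≥0∞) :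
    ∑ a, d.toPMF s a * c = c := by
  rw [← Finset.sum_mul, ← tsum_fintype (L := .unconditional A), PMF.tsum_coe, one_mul]

end Rule

variable {S A AP : Type*} [Fintype S] [Fintype A]
  [MeasurableSpace S] [DiscreteMeasurableSpace S]
  [MeasurableSpace A] [DiscreteMeasurableSpace A]

instance (M : FinMDP S A AP) (π : M.Policy) : IsProbabilityMeasure (M.pathMeasure π) := by
  unfold pathMeasure
  infer_instance

lemma measurable_path (f : List S → S × A → ℝ≥0∞) (t : ℕ) :
    Measurable fun ω : ℕ → S × A => f (pathTo ω t) (ω t) := by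
  have h : Measurable fun x : Finset.Iic t → S × A =>
      f (statesOf x) (x ⟨t, Finset.mem_Iic.2 le_rfl⟩) := measurable_of_finite _
  exact h.comp (Preorder.measurable_frestrictLe (X := fun _ => S × A) t)

open Classical in
lemma map_prodMk_apply {X Y : Type*} (q : PMF Y) (x' x : X) (y : Y) :
    q.map (fun y => (x', y)) (x, y) = if x = x' then q y else 0 := by
  rw [PMF.map_apply, tsum_eq_single y]
  · simp
  · intro y' hy'
    simp [hy'.symm]

lemma bind_map_prodMk_apply {X Y : Type*} (p : PMF X) (q : X → PMF Y) (x : X) (y : Y) :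
    (p.bind fun x => (q x).map fun y => (x, y)) (x, y) = p x * q x y := by
  classical
  rw [PMF.bind_apply, tsum_eq_single x]
  · rw [map_prodMk_apply, if_pos rfl]
  · intro x' hx'
    rw [map_prodMk_apply, if_neg hx'.symm, mul_zero]

lemma lintegral_stepKernel (M : FinMDP S A AP) (π : M.Policy) (n : ℕ)
    (x : Finset.Iic n → S × A) (f : S × A → ℝ≥0∞) :
    ∫⁻ y, f y ∂(M.stepKernel π n x) =
      ∑ s, M.stepPMF (x ⟨n, Finset.mem_Iic.2 le_rfl⟩).1 (x ⟨n, Finset.mem_Iic.2 le_rfl⟩).2 s *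
        ∑ a, (π (statesOf x ++ [s])).toPMF s a * f (s, a) := by
  refine (PMF.lintegral_toMeasure_fintype _ f).trans ?_
  simp_rw [Fintype.sum_prod_type, Finset.mul_sum, bind_map_prodMk_apply, mul_assoc]

/-- The conditional law of the next state and action. -/
theorem lintegral_pathMeasure_succ (M : FinMDP S A AP) (π : M.Policy) (n : ℕ)
    (g : List S → S × A → ℝ≥0∞) :
    ∫⁻ ω, g (pathTo ω (n + 1)) (ω (n + 1)) ∂(M.pathMeasure π) =
      ∫⁻ ω, ∑ s, M.stepPMF (ω n).1 (ω n).2 s *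
        ∑ a, (π (pathTo ω n ++ [s])).toPMF s a * g (pathTo ω n ++ [s]) (s, a)
          ∂(M.pathMeasure π) := by
  have hm : Measurable fun y : (Finset.Iic n → S × A) × (S × A) =>
      g (statesOf y.1 ++ [y.2.1]) y.2 := measurable_of_finite _
  have hr : Measurable (Preorder.frestrictLe (π := fun _ : ℕ => S × A) n) :=
    Preorder.measurable_frestrictLe (X := fun _ => S × A) n
  have h1 := congrArg (fun ν => ∫⁻ y, g (statesOf y.1 ++ [y.2.1]) y.2 ∂ν)
    (Kernel.map_frestrictLe_trajMeasure_compProd_eq_map_trajMeasure (X := fun _ => S × A)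
      (μ₀ := (((π [M.init]).toPMF M.init).map fun a => (M.init, a)).toMeasure)
      (κ := M.stepKernel π) (a := n))
  beta_reduce at h1
  rw [Measure.lintegral_compProd hm, lintegral_map hm (by fun_prop),
    lintegral_map (measurable_of_finite _) hr] at h1
  refine (lintegral_congr fun ω => by rw [pathTo_succ]; rfl).trans (h1.symm.trans ?_)
  refine (lintegral_congr fun ω => ?_)
  exact M.lintegral_stepKernel π n _ _

lemma lintegral_pathMeasure_zero (M : FinMDP S A AP) (π : M.Policy) (g : S × A → ℝ≥0∞) :
    ∫⁻ ω, g (ω 0) ∂(M.pathMeasure π) = ∑ a, (π [M.init]).toPMF M.init a * g (M.init, a) := by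
  have hr : Measurable (Preorder.frestrictLe (π := fun _ : ℕ => S × A) 0) :=
    Preorder.measurable_frestrictLe (X := fun _ => S × A) 0
  have hm : Measurable fun x : Finset.Iic 0 → S × A => g (x ⟨0, Finset.mem_Iic.2 le_rfl⟩) :=
    measurable_of_finite _
  have h0 : Measurable fun ω : ℕ → S × A => g (ω 0) := hm.comp hr
  -- The trajectory kernel started at time 0 leaves the coordinate 0 fixed.
  have h1 : ∀ x : Finset.Iic 0 → S × A,
      ∫⁻ ω, g (ω 0) ∂(Kernel.traj (X := fun _ => S × A) (M.stepKernel π) 0 x) =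
        g (x ⟨0, Finset.mem_Iic.2 le_rfl⟩) := by
    intro x
    have h2 := Kernel.traj_map_frestrictLe_apply (X := fun _ => S × A) (κ := M.stepKernel π) 0 0 x
    rw [Kernel.partialTraj_self, Kernel.id_apply] at h2
    have h3 := lintegral_map (μ := Kernel.traj (X := fun _ => S × A) (M.stepKernel π) 0 x) hm hr
    rw [h2, lintegral_dirac' _ hm] at h3
    exact h3.symm
  unfold pathMeasure Kernel.trajMeasure
  rw [Measure.lintegral_bind (Kernel.aemeasurable _) h0.aemeasurable, lintegral_congr h1,
    lintegral_map hm (by fun_prop)]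
  refine (PMF.lintegral_toMeasure_fintype _ g).trans ?_
  rw [Fintype.sum_prod_type, Finset.sum_eq_single M.init]
  · refine Finset.sum_congr rfl fun a _ => ?_
    rw [map_prodMk_apply, if_pos rfl]
  · refine fun s _ hs => Finset.sum_eq_zero fun a _ => ?_
    rw [map_prodMk_apply, if_neg hs, zero_mul]
  · simp

lemma ae_init (M : FinMDP S A AP) (π : M.Policy) : ∀ᵐ ω ∂(M.pathMeasure π), (ω 0).1 = M.init := by
  classical
  have h := M.lintegral_pathMeasure_zero π fun x => if x.1 = M.init then 0 else 1
  simp only [if_true, mul_zero, Finset.sum_const_zero] at h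
  rw [lintegral_eq_zero_iff (measurable_path (fun _ x => if x.1 = M.init then 0 else 1) 0)] at h
  filter_upwards [h] with ω hω
  simpa using hω

/-- Almost surely, only actions to which the policy gives positive probability are taken. -/
theorem ae_prob_ne_zero (M : FinMDP S A AP) (π : M.Policy) :
    ∀ᵐ ω ∂(M.pathMeasure π), ∀ t, (π (pathTo ω t)).prob (ω t).1 (ω t).2 ≠ 0 := by
  classical
  refine ae_all_iff.2 fun t => ?_
  -- The indicator of a forbidden choice; every rule gives it weight 0.
  set g : List S → S × A → ℝ≥0∞ := fun h x => if (π h).prob x.1 x.2 = 0 then 1 else 0 with hg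
  have hz : ∀ h s a, (π h).toPMF s a * g h (s, a) = 0 := by
    intro h s a
    rw [DecisionRule.toPMF_apply]
    by_cases h0 : (π h).prob s a = 0 <;> simp [hg, h0]
  have h : ∫⁻ ω, g (pathTo ω t) (ω t) ∂(M.pathMeasure π) = 0 := by
    cases t with
    | zero =>
      have h1 : ∀ᵐ ω ∂(M.pathMeasure π), g (pathTo ω 0) (ω 0) = g [M.init] (ω 0) :=
        (M.ae_init π).mono fun ω hω => by simp [pathTo, hω]
      rw [lintegral_congr_ae h1, M.lintegral_pathMeasure_zero π (g [M.init])]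
      exact Finset.sum_eq_zero fun a _ => hz _ _ _
    | succ t =>
      rw [M.lintegral_pathMeasure_succ π t g]
      simp [hz]
  rw [lintegral_eq_zero_iff (measurable_path g t)] at h
  filter_upwards [h] with ω hω
  simpa [hg] using hω

lemma probSat_eq (M : FinMDP S A AP) (φ : ScLTL AP) (π : M.Policy) :
    M.probSat π φ = M.pathMeasure π {ω | ∃ t, M.productState φ t ω ∈ (M.product φ).good} := by
  simp_rw [probSat, models_iff_exists_good]

/-- The paths of `M` under a policy induce a run of the product. -/
theorem isRun_product (M : FinMDP S A AP) (φ : ScLTL AP) (π : M.Policy) :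
    (M.product φ).IsRun (M.pathMeasure π) (M.init, M.residualAfter φ [M.init])
      (M.productState φ) (fun t ω => (ω t).2) where
  meas t f := measurable_path (fun h x => f (x.1, M.residualAfter φ h) x.2) t
  init := (M.ae_init π).mono fun ω hω => by simp [productState, pathTo, hω]
  mem_avail := (M.ae_prob_ne_zero π).mono fun ω hω t => mem_avail_of_prob_ne_zero (hω t)
  step t f := by
    refine (M.lintegral_pathMeasure_succ π t fun h x => f (x.1, M.residualAfter φ h)).trans ?_
    refine lintegral_congr fun ω => Finset.sum_congr rfl fun s _ => ?_
    rw [productState, product_nxt]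
    exact congrArg (_ * ·) ((π (pathTo ω t ++ [s])).sum_toPMF_mul s
      (f (s, M.residualAfter φ (pathTo ω t ++ [s]))))
  good_succ t ω h := by
    rw [productState_succ]
    exact (M.product φ).nxt_good _ h _

end FinMDP

/-! ### Agents with decision horizon one -/

namespace FinMDP

lemma blockStart_one {S : Type*} (h : List S) : blockStart 1 h = h := by
  rw [blockStart, List.take_of_length_le]
  omega

section Agent

variable {S A AP : Type*} [Fintype S]

lemma J_one (M : FinMDP S A AP) (d : Fin 1 → M.DecisionRule) (γ : Fin 1 → S → A → ℝ≥0) (s : S) :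
    M.J d γ s = ∑ a ∈ M.avail s, (d 0).prob s a * (M.reward s a + γ 0 s a) := by
  classical
  rw [J, Fin.sum_univ_one, Finset.sum_eq_single s]
  · refine Finset.sum_congr rfl fun a _ => ?_
    simp [occ]
  · intro s' _ hs'
    refine Finset.sum_eq_zero fun a _ => ?_
    simp [occ, hs']
  · simp

open Classical in
/-- The deterministic decision rule that chooses `f s` in the state `s`. -/
noncomputable def DecisionRule.pure (M : FinMDP S A AP) (f : S → A)
    (hf : ∀ s, f s ∈ M.avail s) : M.DecisionRule where
  prob s a := if a = f s then 1 else 0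
  nonneg s a := by split_ifs <;> simp
  eq_zero s a ha := if_neg (by rintro rfl; exact ha (hf s))
  sum_eq_one s := by simp [hf s]

lemma J_pure (M : FinMDP S A AP) (f : S → A) (hf : ∀ s, f s ∈ M.avail s)
    (γ : Fin 1 → S → A → ℝ≥0) (s : S) :
    M.J (fun _ => DecisionRule.pure M f hf) γ s = M.reward s (f s) + γ 0 s (f s) := by
  rw [J_one, Finset.sum_eq_single_of_mem (f s) (hf s)]
  · simp [DecisionRule.pure]
  · intro a _ ha
    simp [DecisionRule.pure, ha]

/-- An agent with decision horizon one only takes actions that maximize the sum of the reward and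
the incentive. -/
theorem IsOptimalPlan.le_of_prob_ne_zero {M : FinMDP S A AP} {Γ : M.IncentiveDesign 1}
    {σ : M.Plan 1} (hσ : M.IsOptimalPlan Γ σ) {h : List S} {s : S} {a : A}
    (ha : (σ h 0).prob s a ≠ 0) {b : A} (hb : b ∈ M.avail s) :
    M.reward s b + Γ h 0 s b ≤ M.reward s a + Γ h 0 s a := by
  classical
  have hle : ∀ b ∈ M.avail s, M.reward s b + Γ h 0 s b ≤ M.J (σ h) (Γ h) s := by
    intro b hb
    -- The comparison rule deviates to `b` in `s`; elsewhere its choice is immaterial to a one-stage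
    -- objective started in `s`.
    have hf : ∀ s', (if s' = s then b else (M.avail_nonempty s').choose) ∈ M.avail s' := by
      intro s'
      split_ifs with hs
      · rwa [hs]
      · exact (M.avail_nonempty s').choose_spec
    have := hσ h (fun _ => DecisionRule.pure M _ hf) s
    rw [J_pure] at this
    simpa using this
  -- The objective is an average of values it dominates, so every action of positive weight attains
  -- it.
  have hsum : ∑ a ∈ M.avail s, (σ h 0).prob s a *
      (M.J (σ h) (Γ h) s - (M.reward s a + Γ h 0 s a)) = 0 := by
    simp_rw [mul_sub, Finset.sum_sub_distrib, ← Finset.sum_mul]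
    rw [(σ h 0).sum_eq_one, one_mul, J_one, sub_self]
  have h0 := (Finset.sum_eq_zero_iff_of_nonneg fun a ha =>
    mul_nonneg ((σ h 0).nonneg s a) (sub_nonneg.2 (hle a ha))).1 hsum a (mem_avail_of_prob_ne_zero ha)
  have h1 := (mul_eq_zero.1 h0).resolve_left ha
  linarith [hle b hb]

/-- An agent with decision horizon one has an optimal plan under every design. -/
theorem exists_isOptimalPlan (M : FinMDP S A AP) (Γ : M.IncentiveDesign 1) :
    ∃ σ : M.Plan 1, M.IsOptimalPlan Γ σ := by
  have hmax : ∀ (h : List S) (s : S), ∃ a ∈ M.avail s, ∀ b ∈ M.avail s,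
      M.reward s b + Γ h 0 s b ≤ M.reward s a + Γ h 0 s a := fun h s =>
    Finset.exists_max_image (M.avail s) (fun a => M.reward s a + Γ h 0 s a) (M.avail_nonempty s)
  choose f hf hmax using hmax
  refine ⟨fun h _ => DecisionRule.pure M (f h) (hf h), fun h d s => ?_⟩
  rw [J_pure, J_one]
  refine (Finset.sum_le_sum fun a ha =>
    mul_le_mul_of_nonneg_left (hmax h s a ha) ((d 0).nonneg s a)).trans_eq ?_
  rw [← Finset.sum_mul, (d 0).sum_eq_one, one_mul]

/-- The amount by which the reward of `a` falls short of the best reward in the state `s`. -/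
noncomputable def gap (M : FinMDP S A AP) (s : S) (a : A) : ℝ≥0 :=
  ((M.avail s).sup' (M.avail_nonempty s) (M.reward s) - M.reward s a).toNNReal

lemma le_reward_add_gap (M : FinMDP S A AP) {s : S} (a : A) {b : A} (hb : b ∈ M.avail s) :
    M.reward s b ≤ M.reward s a + M.gap s a := by
  have h1 := Finset.le_sup' (M.reward s) hb
  have h2 := Real.le_coe_toNNReal
    ((M.avail s).sup' (M.avail_nonempty s) (M.reward s) - M.reward s a)
  rw [gap]
  linarith

/-- An action is only taken by the agent if the incentive makes up for its gap. -/
lemma IsOptimalPlan.gap_le {M : FinMDP S A AP} {Γ : M.IncentiveDesign 1} {σ : M.Plan 1}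
    (hσ : M.IsOptimalPlan Γ σ) {h : List S} {s : S} {a : A} (ha : (σ h 0).prob s a ≠ 0) :
    M.gap s a ≤ Γ h 0 s a := by
  obtain ⟨b, hb, hbe⟩ := Finset.exists_mem_eq_sup' (M.avail_nonempty s) (M.reward s)
  have h1 := hσ.le_of_prob_ne_zero ha hb
  have h2 := (Γ h 0 s b).coe_nonneg
  rw [gap, Real.toNNReal_le_iff_le_coe, hbe]
  linarith

lemma Plan.toPolicy_one {M : FinMDP S A AP} (σ : M.Plan 1) (h : List S) :
    σ.toPolicy h = σ h 0 := by
  rw [Plan.toPolicy, blockStart_one]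
  exact congrArg _ (Subsingleton.elim _ _)

open Classical in
/-- The design that, while the state of the product is active, pays for the action prescribed by
`f` its gap and the surcharge `δ`. -/
noncomputable def gapDesign (M : FinMDP S A AP) (φ : ScLTL AP)
    (f : S × Set.range φ.residual → A) (δ : ℝ≥0) : M.IncentiveDesign 1 :=
  fun h _ s a => if (s, M.residualAfter φ h) ∈ (M.product φ).active ∧
    a = f (s, M.residualAfter φ h) then M.gap s a + δ else 0

/-- With its gap paid, the prescribed action ties with the best unpaid one; the surcharge breaks the
tie for every optimal plan. -/
lemma IsOptimalPlan.eq_of_gapDesign {M : FinMDP S A AP} {φ : ScLTL AP}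
    {f : S × Set.range φ.residual → A} {δ : ℝ≥0} (hδ : 0 < δ) {σ : M.Plan 1}
    (hσ : M.IsOptimalPlan (M.gapDesign φ f δ) σ) {h : List S} {s : S} {a : A}
    (hact : (s, M.residualAfter φ h) ∈ (M.product φ).active)
    (hf : f (s, M.residualAfter φ h) ∈ M.avail s) (ha : (σ h 0).prob s a ≠ 0) :
    a = f (s, M.residualAfter φ h) := by
  by_contra hne
  have h1 := hσ.le_of_prob_ne_zero ha hf
  have h2 := M.le_reward_add_gap (f (s, M.residualAfter φ h)) (mem_avail_of_prob_ne_zero ha)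
  have h3 : (0 : ℝ) < δ := hδ
  simp only [gapDesign, hact, hne, and_false, and_true, if_true, if_false, NNReal.coe_add,
    NNReal.coe_zero] at h1
  linarith

end Agent

/-! ### Cost of designs and the limit of vanishing surcharges -/

section Design

variable {S A AP : Type*} [Fintype S] [Fintype A]
  [MeasurableSpace S] [DiscreteMeasurableSpace S]
  [MeasurableSpace A] [DiscreteMeasurableSpace A]

lemma cost_one (M : FinMDP S A AP) (Γ : M.IncentiveDesign 1) (σ : M.Plan 1) :
    M.cost Γ σ = ∑' t, ∫⁻ ω, Γ (pathTo ω t) 0 (ω t).1 (ω t).2 ∂(M.pathMeasure σ.toPolicy) := by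
  rw [← lintegral_tsum fun t =>
    (measurable_path (fun h x => (Γ h 0 x.1 x.2 : ℝ≥0∞)) t).aemeasurable]
  refine lintegral_congr fun ω => tsum_congr fun t => ?_
  rw [blockStart_one, Subsingleton.elim (Fin.ofNat 1 t) 0]

lemma ae_plan_prob_ne_zero (M : FinMDP S A AP) (σ : M.Plan 1) :
    ∀ᵐ ω ∂(M.pathMeasure σ.toPolicy), ∀ t, (σ (pathTo ω t) 0).prob (ω t).1 (ω t).2 ≠ 0 := by
  filter_upwards [M.ae_prob_ne_zero σ.toPolicy] with ω hω t
  have := hω t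
  rwa [Plan.toPolicy_one] at this

lemma IsOptimalPlan.tsum_gap_le_cost {M : FinMDP S A AP} {Γ : M.IncentiveDesign 1} {σ : M.Plan 1}
    (hσ : M.IsOptimalPlan Γ σ) :
    ∑' t, ∫⁻ ω, M.gap (ω t).1 (ω t).2 ∂(M.pathMeasure σ.toPolicy) ≤ M.cost Γ σ := by
  rw [cost_one]
  refine ENNReal.tsum_le_tsum fun t => lintegral_mono_ae ?_
  filter_upwards [M.ae_plan_prob_ne_zero σ] with ω hω
  exact ENNReal.coe_le_coe.2 (hσ.gap_le (hω t))

/-- The cost per step of the product under `gapDesign`. -/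
noncomputable def gapCost (M : FinMDP S A AP) (φ : ScLTL AP) (δ : ℝ≥0∞) :
    S × Set.range φ.residual → A → ℝ≥0∞ :=
  fun z a => M.gap z.1 a + δ

/-- The least cost at which the principal has the agent satisfy `φ` with maximal probability, if
a surcharge `δ` is paid in each step. -/
noncomputable def surchargedCost (M : FinMDP S A AP) (φ : ScLTL AP) (δ : ℝ≥0∞) : ℝ≥0∞ :=
  (M.product φ).minCost (M.gapCost φ δ) (M.init, M.residualAfter φ [M.init])

/-- If `f` prescribes cost-minimizing actions, then every agent optimal under `gapDesign`
satisfies `φ` with maximal probability, at the minimal cost. -/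
theorem IsOptimalPlan.gapDesign_spec {M : FinMDP S A AP} {φ : ScLTL AP}
    {f : S × Set.range φ.residual → A} {δ : ℝ≥0} (hδ : 0 < δ)
    (hfc : ∀ z ∈ (M.product φ).active, f z ∈ (M.product φ).conserving z)
    (hfm : ∀ z ∈ (M.product φ).active, M.gapCost φ δ z (f z) +
      (M.product φ).exp z (f z) ((M.product φ).minCost (M.gapCost φ δ)) ≤
        (M.product φ).minCost (M.gapCost φ δ) z)
    (hfin : M.surchargedCost φ δ ≠ ∞) {σ : M.Plan 1}
    (hσ : M.IsOptimalPlan (M.gapDesign φ f δ) σ) :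
    (M.product φ).reach (M.init, M.residualAfter φ [M.init]) ≤ M.probSat σ.toPolicy φ ∧
      M.cost (M.gapDesign φ f δ) σ ≤ M.surchargedCost φ δ := by
  classical
  have hrun := M.isRun_product φ σ.toPolicy
  have hα : ∀ᵐ ω ∂(M.pathMeasure σ.toPolicy), ∀ t,
      M.productState φ t ω ∈ (M.product φ).active → (ω t).2 = f (M.productState φ t ω) := by
    filter_upwards [M.ae_plan_prob_ne_zero σ] with ω hω t hact
    exact hσ.eq_of_gapDesign hδ hact ((M.product φ).mem_conserving.1 (hfc _ hact)).1 (hω t)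
  have hcost : M.cost (M.gapDesign φ f δ) σ = ∑' t, ∫⁻ ω,
      (if M.productState φ t ω ∈ (M.product φ).active then
        M.gapCost φ δ (M.productState φ t ω) (ω t).2 else 0) ∂(M.pathMeasure σ.toPolicy) := by
    rw [cost_one]
    refine tsum_congr fun t => lintegral_congr_ae ?_
    filter_upwards [hα] with ω hω
    by_cases hact : M.productState φ t ω ∈ (M.product φ).active
    · have h1 := hω t hact
      rw [if_pos hact, gapDesign, if_pos ⟨hact, h1⟩, ENNReal.coe_add]
      rfl
    · rw [if_neg hact, gapDesign, if_neg fun h => hact h.1, ENNReal.coe_zero]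
  have hle := hrun.tsum_lintegral_le_minCost (M.gapCost φ δ) (by
    filter_upwards [hα] with ω hω t hact
    rw [hω t hact]
    exact hfm _ hact)
  refine ⟨?_, hcost.trans_le hle⟩
  rw [probSat_eq]
  refine hrun.reach_le_measure_exists_good (δ := δ) (by exact_mod_cast hδ.ne')
    (k := M.gapCost φ δ) (fun z a => le_add_self) ?_ (ne_top_of_le_ne_top hfin hle)
  filter_upwards [hα] with ω hω t hact
  rw [hω t hact]
  exact hfc _ hact

lemma finite_range_subtype (φ : ScLTL AP) : Finite (Set.range φ.residual) :=
  φ.finite_range_residual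

lemma probSat_le_reach (M : FinMDP S A AP) (φ : ScLTL AP) (π : M.Policy) :
    M.probSat π φ ≤ (M.product φ).reach (M.init, M.residualAfter φ [M.init]) := by
  rw [probSat_eq]
  exact (M.isRun_product φ π).measure_exists_good_le

/-- The costs with small surcharges are finite, and their infimum bounds the cost of the designs
under which the agent satisfies `φ` with maximal probability. -/
theorem exists_surchargedCost (M : FinMDP S A AP) (φ : ScLTL AP) :
    ∃ B ≠ ∞, (∀ δ ≤ 1, M.surchargedCost φ δ ≤ B) ∧
      ∀ (Γ : M.IncentiveDesign 1) (σ : M.Plan 1), M.IsOptimalPlan Γ σ →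
        (M.product φ).reach (M.init, M.residualAfter φ [M.init]) ≤ M.probSat σ.toPolicy φ →
        ⨅ n : ℕ, M.surchargedCost φ (n + 1 : ℕ)⁻¹ ≤ M.cost Γ σ := by
  classical
  have := finite_range_subtype φ
  -- The summand 1 accommodates every surcharge δ ≤ 1.
  set K : ℝ≥0 := (Finset.univ.sup fun x : S × A => M.gap x.1 x.2) + 1 with hK
  obtain ⟨B, hB, hBk⟩ := (M.product φ).exists_minCost_le (K := K) ENNReal.coe_ne_top
  have hbound : ∀ δ ≤ 1, ∀ z, (M.product φ).minCost (M.gapCost φ δ) z ≤ B := by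
    refine fun δ hδ => hBk _ fun z a => ?_
    rw [hK, ENNReal.coe_add, ENNReal.coe_one]
    exact add_le_add (ENNReal.coe_le_coe.2
      (Finset.le_sup (f := fun x : S × A => M.gap x.1 x.2) (Finset.mem_univ (z.1, a)))) hδ
  refine ⟨B, hB, fun δ hδ => hbound δ hδ _, fun Γ σ hσ hmax => ?_⟩
  rw [probSat_eq] at hmax
  have hrun := M.isRun_product φ σ.toPolicy
  -- Here `n` is the truncation time and `1 / (m + 1)` the surcharge. The order of limits matters:
  -- `m → ∞` for fixed `n` removes the surcharge term, then `n → ∞` removes the tail.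
  have key : ∀ n m : ℕ, ⨅ n : ℕ, M.surchargedCost φ (n + 1 : ℕ)⁻¹ ≤ M.cost Γ σ +
      n * ((m + 1 : ℕ) : ℝ≥0∞)⁻¹ + B * M.pathMeasure σ.toPolicy
        {ω | M.productState φ n ω ∈ (M.product φ).active} := by
    intro n m
    have h1 : ((m + 1 : ℕ) : ℝ≥0∞)⁻¹ ≤ 1 := ENNReal.inv_le_one.2 (by exact_mod_cast Nat.succ_pos m)
    refine (iInf_le _ m).trans ((hrun.minCost_add_const_le (fun z a => (M.gap z.1 a : ℝ≥0∞)) _ B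
      (hbound _ h1) hmax n).trans ?_)
    gcongr
    exact hσ.tsum_gap_le_cost
  have key' : ∀ n : ℕ, ⨅ n : ℕ, M.surchargedCost φ (n + 1 : ℕ)⁻¹ ≤ M.cost Γ σ +
      B * M.pathMeasure σ.toPolicy {ω | M.productState φ n ω ∈ (M.product φ).active} := by
    intro n
    have h1 := (Filter.tendsto_add_atTop_iff_nat 1).2 ENNReal.tendsto_inv_nat_nhds_zero
    have h2 := ENNReal.Tendsto.const_mul h1 (Or.inr (ENNReal.natCast_ne_top n))
    have h3 := (tendsto_const_nhds (x := M.cost Γ σ)).add h2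
    have h4 := h3.add (tendsto_const_nhds (x := B * M.pathMeasure σ.toPolicy
      {ω | M.productState φ n ω ∈ (M.product φ).active}))
    rw [mul_zero, add_zero] at h4
    exact ge_of_tendsto' h4 (key n)
  have h1 := ENNReal.Tendsto.const_mul (hrun.tendsto_measure_active hmax) (Or.inr hB)
  have h2 := (tendsto_const_nhds (x := M.cost Γ σ)).add h1
  rw [mul_zero, add_zero] at h2
  exact ge_of_tendsto' h2 key'

end Design

end FinMDP

theorem proposition2 {S A AP : Type*} [Fintype S] [Fintype A]
    [MeasurableSpace S] [DiscreteMeasurableSpace S]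
    [MeasurableSpace A] [DiscreteMeasurableSpace A]
    (M : FinMDP S A AP) (φ : ScLTL AP) (ε : ℝ≥0) (hε : 0 < ε) :
    ∃ Γ : M.IncentiveDesign 1, M.IsEpsOptimalDesign φ ε Γ := by
  classical
  obtain ⟨B, hB, hle, hlow⟩ := M.exists_surchargedCost φ
  have hone : ∀ n : ℕ, ((n + 1 : ℕ) : ℝ≥0∞)⁻¹ ≤ 1 := fun n =>
    ENNReal.inv_le_one.2 (by exact_mod_cast Nat.succ_pos n)
  have hI : ⨅ n : ℕ, M.surchargedCost φ (n + 1 : ℕ)⁻¹ ≠ ∞ :=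
    ne_top_of_le_ne_top hB ((iInf_le _ 0).trans (hle _ (hone 0)))
  -- The infimum over surcharges need not be attained; ε leaves room for a positive one.
  obtain ⟨n, hn⟩ := iInf_lt_iff.1
    (ENNReal.lt_add_right hI (by exact_mod_cast hε.ne' : (ε : ℝ≥0∞) ≠ 0))
  set δ : ℝ≥0 := ((n + 1 : ℕ) : ℝ≥0)⁻¹ with hδ
  have hδpos : 0 < δ := by positivity
  have hδe : (δ : ℝ≥0∞) = ((n + 1 : ℕ) : ℝ≥0∞)⁻¹ := by
    rw [hδ, ENNReal.coe_inv (by positivity), ENNReal.coe_natCast]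
  have hmin : ∀ z, ∃ a, z ∈ (M.product φ).active → a ∈ (M.product φ).conserving z ∧
      M.gapCost φ δ z a + (M.product φ).exp z a ((M.product φ).minCost (M.gapCost φ δ)) ≤
        (M.product φ).minCost (M.gapCost φ δ) z := by
    intro z
    by_cases hz : z ∈ (M.product φ).active
    · obtain ⟨a, ha, h⟩ := (M.product φ).exists_le_minCost (M.gapCost φ δ) hz
      exact ⟨a, fun _ => ⟨ha, h⟩⟩
    · exact ⟨(M.avail_nonempty z.1).choose, fun h => absurd h hz⟩
  choose f hf using hmin
  have hfin : M.surchargedCost φ δ ≠ ∞ :=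
    ne_top_of_le_ne_top hB (hle _ (hδe.trans_le (hone n)))
  have hspec := fun (σ : M.Plan 1) (hσ : M.IsOptimalPlan (M.gapDesign φ f δ) σ) =>
    hσ.gapDesign_spec hδpos (fun z hz => (hf z hz).1) (fun z hz => (hf z hz).2) hfin
  obtain ⟨σ₀, hσ₀⟩ := M.exists_isOptimalPlan (M.gapDesign φ f δ)
  refine ⟨M.gapDesign φ f δ, ⟨σ₀, hσ₀⟩, fun σ hσ => ⟨fun π' =>
    (M.probSat_le_reach φ π').trans (hspec σ hσ).1,
    ne_top_of_le_ne_top hfin (hspec σ hσ).2, fun Γ' σ' hσ' hmax => ?_⟩⟩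
  refine (hspec σ hσ).2.trans ?_
  rw [hδe]
  -- The plan `σ₀` attains the bound `reach`, so a competitor of maximal probability attains it as
  -- well, as `hlow` requires.
  exact hn.le.trans (add_le_add (hlow Γ' σ' hσ' ((hspec σ₀ hσ₀).1.trans (hmax _))) le_rfl)
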